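/- Let $X$ be a finite connected cube complex with embedded cubes (so $X$ is described by the poset of its closed cubes, in which the cubes contained in a given cube $\square$ form the poset of faces of a standard cube). Two distinct vertices of $X$ are \emph{adjacent} if they are joined by an edge; the \emph{cubical distance} $d_{\mathrm{cube}}(v,w)$ is the least $n$ for which there are vertices $v=u_0,\dots,u_n=w$ such that any two consecutive $u_i,u_{i+1}$ lie in a common cube. The cubical $k$-neighborhood of $v$ is the subcomplex spanned by all vertices at cubical distance at most $k$ from $v$, i.e. it consists of all cubes all of whose vertices are at cubical distance at most $k$ from $v$. Assume: (i) $X$ is \emph{$5$-large}: the link of every vertex is a simplicial complex that is flag and in which no embedded cycle of length less than $5$ is a full subcomplex, and the cubical $2$-neighborhood of every vertex is contractible; (ii) $X$ has \emph{no disconnecting cubes}: there is no closed cube $\square$ of $X$ such that $X\setminus\square$ is disconnected; (iii) $X$ has \emph{no isolated corners}: for every cube $\square$ of $X$ and every vertex $v\in\square$ there is a vertex $w$ adjacent to $v$ with $w\notin\square$. Let $\mathbb T(X)$ be the simplicial complex whose vertices are the ordered pairs $v_w=(v,w)$ of vertices of $X$ with $d_{\mathrm{cube}}(v,w)\ge 2$,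 in which finitely many vertices span a simplex if and only if their first coordinates lie in a common cube of $X$, and let $\Gamma$ be the $1$-skeleton of $\mathbb T(X)$. Fix an indexing $x_1,\dots,x_k$ of the vertices of $X$, and define the initial state $\mathcal S\colon V(\Gamma)\to\mathbb Z/2$ by $\mathcal S(v_w)=1$ if and only if $v=x_i$, $w=x_j$ with $i<j$. For every vertex $v_w$ of $\Gamma$ let $m_{vw}\colon V(\Gamma)\to\mathbb Z/2$ be $1$ at $v_w$ and at $w_v$, and $0$ at all other vertices. Then $\{m_{vw}\}$ is a legal system of moves on $\Gamma$, with legal orbit that of $\mathcal S$. That is: for every vertex $v_w$ of $\Gamma$ one has $m_{vw}(v_w)=1$ and $m_{vw}(u)=0$ for all neighbours $u$ of $v_w$ in $\Gamma$; and if $M\le(\mathbb Z/2)^{V(\Gamma)}$ is the subgroup generated by all $m_{vw}$, then $\mathcal S$ and every state $m+\mathcal S$ with $m\in M$ is legal, i.e. the subgraphs of $\Gamma$ induced on $(m+\mathcal S)^{-1}(0)$ and $(m+\mathcal S)^{-1}(1)$ are both nonempty and connected. -/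

import Mathlib

open scoped Classical in
/-- The edge joining two vertices (a single vertex if they coincide), as a finite set. -/
noncomputable def vertexPair {V : Type*} (a b : V) : Finset V := {a, b}

/-! ### Simplicial complexes -/

namespace AbstractSimplicialComplex

variable {V : Type*}

/-- The `1`-skeleton of a simplicial complex, as a simple graph. -/
def oneSkeletonGraph (K : AbstractSimplicialComplex V) : SimpleGraph V where
  Adj a b := a ≠ b ∧ vertexPair a b ∈ K.faces
  symm := ⟨fun a b h => ⟨h.1.symm, by
    have hab : vertexPair b a = vertexPair a b := by
      ext; simp [vertexPair, or_comm]
    rw [hab]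
    exact h.2⟩⟩
  loopless := ⟨fun _ h => h.1 rfl⟩

/-- Flag: every nonempty finite set of pairwise adjacent vertices spans a simplex. -/
def IsFlag (K : AbstractSimplicialComplex V) : Prop :=
  ∀ s : Finset V, s.Nonempty →
    (∀ a ∈ s, ∀ b ∈ s, a ≠ b → K.oneSkeletonGraph.Adj a b) → s ∈ K.faces

/-- `c` is an embedded cycle of length `n` in `K`. -/
def IsEmbeddedCycle (K : AbstractSimplicialComplex V) (n : ℕ) (c : ZMod n → V) : Prop :=
  3 ≤ n ∧ Function.Injective c ∧ ∀ i, K.oneSkeletonGraph.Adj (c i) (c (i + 1))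

/-- The cycle `c` is a full subcomplex of `K`: every simplex of `K` all of whose vertices lie on
the cycle is a vertex or an edge of the cycle. -/
def IsFullCycle (K : AbstractSimplicialComplex V) (n : ℕ) (c : ZMod n → V) : Prop :=
  ∀ s ∈ K.faces, (s : Set V) ⊆ Set.range c →
    ∃ i, s = {c i} ∨ s = vertexPair (c i) (c (i + 1))

/-- `k`-large: flag, and no embedded cycle of length `< k` is full. -/
def IsLarge (K : AbstractSimplicialComplex V) (k : ℕ) : Prop :=
  K.IsFlag ∧ ∀ (n : ℕ) (c : ZMod n → V), n < k → K.IsEmbeddedCycle n c → ¬ K.IsFullCycle n c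

end AbstractSimplicialComplex

/-! ### Cube complexes -/

/-- The poset of (nonempty) faces of the cube `[0,1]ⁿ`, ordered by inclusion: a face is a product
of faces of `[0,1]`, and a face of `[0,1]` is given by the nonempty set of its endpoints, a subset
of `Bool`. -/
abbrev CubeFace (n : ℕ) : Type := Fin n → {s : Finset Bool // s.Nonempty}

/-- A cube complex, given by its set `P` of (closed) cubes ordered by inclusion: the cubes contained
in a cube `p` form the poset of faces of the cube of dimension `dim p`. -/
structure CubeComplex (P : Type*) [PartialOrder P] where
  dim : P → ℕ
  faces_cube : ∀ p : P, Nonempty (Set.Iic p ≃o CubeFace (dim p))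

namespace CubeComplex

variable {P : Type*} [PartialOrder P]

/-- The vertices of `X`: the cubes of dimension `0`. The vertex `v` lies in the cube `p` if and only
if `v.1 ≤ p`. -/
abbrev Vertex (X : CubeComplex P) : Type _ := {v : P // X.dim v = 0}

/-- Two distinct vertices are adjacent if they are the endpoints of an edge. -/
def Adjacent (X : CubeComplex P) (v w : X.Vertex) : Prop :=
  v ≠ w ∧ ∃ e : P, X.dim e = 1 ∧ v.1 ≤ e ∧ w.1 ≤ e

/-- The graph joining two distinct vertices if they lie in a common cube. -/
def cubeGraph (X : CubeComplex P) : SimpleGraph X.Vertex where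
  Adj v w := v ≠ w ∧ ∃ p : P, v.1 ≤ p ∧ w.1 ≤ p
  symm := ⟨fun _ _ ⟨h, p, hv, hw⟩ => ⟨h.symm, p, hw, hv⟩⟩
  loopless := ⟨fun _ h => h.1 rfl⟩

/-- The cubical distance between two vertices. -/
noncomputable def cubeDist (X : CubeComplex P) (v w : X.Vertex) : ℕ∞ := X.cubeGraph.edist v w

/-- The cubical `k`-neighborhood of the vertex `v`, as a set of cubes: the subcomplex spanned by the
vertices at cubical distance at most `k` from `v`. -/
def cubicalNeighborhood (X : CubeComplex P) (k : ℕ) (v : X.Vertex) : Set P :=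
  {p | ∀ w : X.Vertex, w.1 ≤ p → X.cubeDist v w ≤ k}

/-- The geometric realization of the subcomplex of `X` with set of cubes `K`, via the barycentric
subdivision: the vertices of the subdivision are the barycenters of the cubes, a set of barycenters
spans a simplex if and only if the cubes form a chain, and a point is given by its barycentric
coordinates. The realization of `X` itself is that of `Set.univ`, and the closed cube `p` is the
realization of `Set.Iic p`. -/
def realization [Fintype P] (_X : CubeComplex P) (K : Set P) : Set (P → ℝ) :=
  {x | (∀ p, 0 ≤ x p) ∧ ∑ p, x p = 1 ∧ IsChain (· ≤ ·) (Function.support x) ∧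
    Function.support x ⊆ K}

/-- The edges of `X` at the vertex `v`; these are the vertices of the link of `v`. -/
abbrev EdgeAt (X : CubeComplex P) (v : X.Vertex) : Type _ := {e : P // X.dim e = 1 ∧ v.1 ≤ e}

/-- The cells of the link of `v` are the cubes of positive dimension that contain `v`, the cube `p`
giving a simplex whose vertices are the edges of `p` at `v`. The link is a simplicial complex if and
only if these simplices are determined by their vertices. -/
def LinkIsSimplicial (X : CubeComplex P) (v : X.Vertex) : Prop :=
  ∀ p q : P, v.1 < p → v.1 < q → (∀ e : X.EdgeAt v, e.1 ≤ p ↔ e.1 ≤ q) → p = q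

/-- The link of the vertex `v`: edges at `v` span a simplex if and only if they lie in a common
cube (and then they are the edges at `v` of a face of that cube). -/
def link (X : CubeComplex P) (v : X.Vertex) : AbstractSimplicialComplex (X.EdgeAt v) where
  faces := {s | s.Nonempty ∧ ∃ p : P, ∀ e ∈ s, e.1 ≤ p}
  isRelLowerSet_faces := fun _ ⟨hs, p, hp⟩ =>
    ⟨hs, fun _ hts ht => ⟨ht, p, fun e he => hp e (hts he)⟩⟩
  singleton_mem e := ⟨Finset.singleton_nonempty e, e.1, fun f hf => by
    rw [Finset.mem_singleton.mp hf]⟩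

/-- Locally `k`-large: the link of every vertex is a `k`-large simplicial complex. -/
def IsLocallyLarge (X : CubeComplex P) (k : ℕ) : Prop :=
  ∀ v : X.Vertex, X.LinkIsSimplicial v ∧ (X.link v).IsLarge k

/-- `5`-large: locally `5`-large, and all cubical `2`-neighborhoods of vertices are contractible. -/
def IsFiveLarge [Fintype P] (X : CubeComplex P) : Prop :=
  X.IsLocallyLarge 5 ∧
    ∀ v : X.Vertex, ContractibleSpace (X.realization (X.cubicalNeighborhood 2 v))

/-- For every cube `p` and every vertex `v` of `p` there is a vertex adjacent to `v` outside `p`. -/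
def NoIsolatedCorners (X : CubeComplex P) : Prop :=
  ∀ (p : P) (v : X.Vertex), v.1 ≤ p → ∃ w : X.Vertex, X.Adjacent v w ∧ ¬ w.1 ≤ p

/-- There is no (closed) cube whose removal disconnects `X`. -/
def NoDisconnectingCubes [Fintype P] (X : CubeComplex P) : Prop :=
  ∀ p : P, IsPreconnected (X.realization Set.univ \ X.realization (Set.Iic p))

/-- The `α`-thickening of `X`: the simplicial complex with vertex set `Y` in which a nonempty finite
set spans a simplex if and only if its image under `α` lies in a common cube. -/
def alphaThickening (X : CubeComplex P) {Y : Type*} (α : Y → X.Vertex) :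
    AbstractSimplicialComplex Y where
  faces := {s | s.Nonempty ∧ ∃ p : P, ∀ y ∈ s, (α y).1 ≤ p}
  isRelLowerSet_faces := fun _ ⟨hs, p, hp⟩ =>
    ⟨hs, fun _ hts ht => ⟨ht, p, fun y hy => hp y (hts hy)⟩⟩
  singleton_mem y := ⟨Finset.singleton_nonempty y, (α y).1, fun z hz => by
    rw [Finset.mem_singleton.mp hz]⟩

/-- The vertices `v_w = (v, w)` of `𝕋(X)`: ordered pairs at cubical distance at least `2`. -/
abbrev TVertex (X : CubeComplex P) : Type _ := {y : X.Vertex × X.Vertex // 2 ≤ X.cubeDist y.1 y.2}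

/-- The thickening `𝕋(X)`: the `α`-thickening for `α (v_w) = v`. -/
def thickening (X : CubeComplex P) : AbstractSimplicialComplex X.TVertex :=
  X.alphaThickening fun y => y.1.1

open scoped Classical in
/-- The initial state for an indexing `x` of the vertices: `v_w ↦ 1` if and only if the index of `v`
is smaller than that of `w`. -/
noncomputable def initialState (X : CubeComplex P) {k : ℕ} (x : X.Vertex ≃ Fin k) :
    X.TVertex → ZMod 2 :=
  fun y => if x y.1.1 < x y.1.2 then 1 else 0

open scoped Classical in
/-- The move `m_{vw}` at the vertex `y = v_w`: it is `1` at `v_w` and `w_v`, and `0` elsewhere. -/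
noncomputable def pairMove (X : CubeComplex P) (y : X.TVertex) : X.TVertex → ZMod 2 :=
  fun z => if z.1 = y.1 ∨ z.1 = y.1.swap then 1 else 0

end CubeComplex

/-! ### States and moves on a graph -/

namespace SimpleGraph

variable {V : Type*}

/-- A state `φ` is legal if the subgraphs induced by `φ⁻¹(0)` and `φ⁻¹(1)` are both connected and
nonempty (`SimpleGraph.Connected` includes nonemptiness). -/
def IsLegalState (Γ : SimpleGraph V) (φ : V → ZMod 2) : Prop :=
  ∀ ε : ZMod 2, (Γ.induce {v | φ v = ε}).Connected

/-- `m` is a move at `v`: it is `1` at `v` and `0` at the neighbours of `v`. -/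
def IsMoveAt (Γ : SimpleGraph V) (v : V) (m : V → ZMod 2) : Prop :=
  m v = 1 ∧ ∀ u, Γ.Adj u v → m u = 0

/-- A system of moves: a move at every vertex. -/
def IsSystemOfMoves (Γ : SimpleGraph V) (m : V → V → ZMod 2) : Prop :=
  ∀ v, Γ.IsMoveAt v (m v)

/-- The orbit of the state `S` under the group of states generated by `m` is a legal orbit: `S` and
all states `μ + S` are legal, where `μ` runs over the subgroup generated by the moves `m v`. -/
def IsLegalOrbit (Γ : SimpleGraph V) (m : V → V → ZMod 2) (S : V → ZMod 2) : Prop :=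
  Γ.IsLegalState S ∧ ∀ μ ∈ AddSubgroup.closure (Set.range m), Γ.IsLegalState (μ + S)

/-- A system of moves is legal if some state has a legal orbit. -/
def IsLegalSystemOfMoves (Γ : SimpleGraph V) (m : V → V → ZMod 2) : Prop :=
  Γ.IsSystemOfMoves m ∧ ∃ S, Γ.IsLegalOrbit m S

end SimpleGraph

/-!
A state in the orbit of the initial state takes different values at `v_w` and `w_v` for all `v`, `w`,
because the initial state does and the moves are symmetric. Every state `φ` with this property is
legal. Indeed, fix `ε`. Two vertices `v` of `X` for which no `v_w` has state `ε` are at cubical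
distance at most `1`, so these vertices lie pairwise in common cubes, and hence in a single cube `p`
(`exists_cube_of_clique`). The complement of `p` is connected, every cube outside `p` has a vertex
outside `p` (`le_of_vertices_le`), and every vertex of `p` has a neighbour outside `p`; so the
subgraph induced on `φ⁻¹(ε)` is connected (`isLegalState_of_swap`).

The two facts about cubes would be standard in a CAT(0) cube complex. Here they have to be extracted
from flagness of the links and contractibility of the cubical `2`-neighborhoods. Call an edge path
reduced if none of its darts can be moved backwards across squares until it cancels against its
reversal. Reduced words up to shuffles of square corners carry an action of the darts, by cancelling
or appending, and by flagness the two ways around a square act equally (`DartSystem.act_square`).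
This is a flat local system whose monodromy over a contractible subcomplex is trivial
(`exists_compatible_family`, proved by lifting a contraction to the covering given by the local
system). Therefore reduced paths in a cubical `2`-neighborhood of their starting point that end at
the same vertex agree up to shuffles (`shuffle_of_endpoint_eq`), and a shuffle of a path in a cube
stays in that cube (`Shuffle.edge_le`).

Applied to paths in two cubes, this shows that two vertices of a cube span a face that lies in all
cubes containing both (`exists_span`). Applied to a path through two cubes and a path in a third,
it shows that three pairwise intersecting cubes, as in a clique of three vertices, have a common
vertex (`exists_common_vertex`). Flagness of the link of that vertex gives the statement on cliques of
three vertices, and flagness of the link of one vertex of a clique gives the general case.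
-/

/-! ### Edge words in a system of darts -/

/-- The local structure of a nonpositively curved cube complex that is seen by edge paths: a set of
darts (oriented edges) with source, target and reversal, and the relation `par d f f'` saying that
the darts `d` and `f` leave the same vertex and span a square in which `f'` is the edge opposite to
`f`, leaving the target of `d`. The field `par_cube` records that three pairwise orthogonal darts
span a `3`-cube. -/
structure DartSystem (V D : Type*) where
  src : D → V
  tgt : D → V
  rev : D → D
  par : D → D → D → Prop
  rev_rev : ∀ d, rev (rev d) = d
  src_rev : ∀ d, src (rev d) = tgt d
  par_src : ∀ {d f f'}, par d f f' → src d = src f ∧ src f' = tgt d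
  par_unique : ∀ {d f f₁ f₂}, par d f f₁ → par d f f₂ → f₁ = f₂
  par_rev : ∀ {d f f'}, par d f f' → par (rev d) f' f
  par_swap : ∀ {d f f'}, par d f f' →
    ∃ d', par f d d' ∧ par f' (rev d) (rev d') ∧ tgt d' = tgt f'
  par_irrefl : ∀ d f, ¬ par d d f
  par_cube : ∀ {d f g f' g' g''}, par d f f' → par d g g' → par f g g'' →
    ∃ h d', par f d d' ∧ par f' g' h ∧ par d' g'' h

namespace DartSystem

variable {V D : Type*} (S : DartSystem V D)

theorem tgt_rev (d : D) : S.tgt (S.rev d) = S.src d := by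
  rw [← S.src_rev, S.rev_rev]

theorem par_rev' {d f f' : D} (h : S.par (S.rev d) f f') : S.par d f' f := by
  have := S.par_rev h
  rwa [S.rev_rev] at this

/-- Shuffle equivalence of edge words: the equivalence relation generated by exchanging two
consecutive darts that run along two sides of a square for the two opposite ones. Words are
lists of darts whose head is the *last* dart. -/
inductive Shuffle : List D → List D → Prop
  | refl (γ) : Shuffle γ γ
  | swap {f g f' g'} (γ) : S.par (S.rev f) g g' → S.par g' f f' →
      Shuffle (g :: f :: γ) (f' :: g' :: γ)
  | cons {γ δ} (f) : Shuffle γ δ → Shuffle (f :: γ) (f :: δ)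
  | trans {γ δ ε} : Shuffle γ δ → Shuffle δ ε → Shuffle γ ε

/-- `Cancel γ e δ`: the dart `e` can be moved backwards along the word `γ`, across squares, until it
meets its own reversal; `δ` is what remains after the two have cancelled. -/
inductive Cancel : List D → D → List D → Prop
  | here (f γ) : Cancel (f :: γ) (S.rev f) γ
  | there {f e e' f' γ δ} : S.par (S.rev f) e e' → S.par e' f f' → Cancel γ e' δ →
      Cancel (f :: γ) e (f' :: δ)

/-- A word is reduced if none of its darts cancels against the darts preceding it. -/
def Reduced : List D → Prop
  | [] => True
  | f :: γ => Reduced γ ∧ ∀ δ, ¬ S.Cancel γ f δ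

/-- The final vertex of a word starting at `v`. -/
def endpoint (v : V) : List D → V
  | [] => v
  | f :: _ => S.tgt f

/-- The word is an edge path starting at `v`. -/
def IsPath (v : V) : List D → Prop
  | [] => True
  | f :: γ => IsPath v γ ∧ S.src f = S.endpoint v γ

variable {S}

theorem Shuffle.symm {γ δ : List D} (h : S.Shuffle γ δ) : S.Shuffle δ γ := by
  induction h with
  | refl γ => exact .refl γ
  | swap γ h₁ h₂ => exact .swap γ (S.par_rev h₂) (S.par_rev' h₁)
  | cons f _ ih => exact .cons f ih
  | trans _ _ ih₁ ih₂ => exact ih₂.trans ih₁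

/-- The fourth side of a square. -/
theorem par_fourth {f g f' g' : D} (h₁ : S.par (S.rev f) g g') (h₂ : S.par g' f f') :
    S.par g (S.rev f) (S.rev f') := by
  obtain ⟨d, hd, hd', -⟩ := S.par_swap h₁
  rw [S.rev_rev] at hd'
  rwa [S.par_unique h₂ hd', S.rev_rev]

theorem Cancel.unique {γ δ δ' : List D} {e : D} (h : S.Cancel γ e δ) (h' : S.Cancel γ e δ') :
    δ = δ' := by
  induction h generalizing δ' with
  | here f γ =>
    generalize he : S.rev f = e at h'
    cases h' with
    | here => rfl
    | there h₁ => exact (S.par_irrefl _ _ (he ▸ h₁)).elim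
  | @there f e e' f' γ δ h₁ h₂ _ ih =>
    cases h' with
    | here => exact (S.par_irrefl _ _ h₁).elim
    | there h₃ h₄ h₅ =>
      obtain rfl := S.par_unique h₁ h₃
      rw [S.par_unique h₂ h₄, ih h₅]

/-- Cancellation is compatible with shuffles. This is where `3`-cubes enter: a dart that crosses both
darts of a shuffled pair spans a `3`-cube with them. -/
theorem Cancel.shuffle {γ γ' δ : List D} {e : D} (hs : S.Shuffle γ γ') (h : S.Cancel γ e δ) :
    ∃ δ', S.Cancel γ' e δ' ∧ S.Shuffle δ δ' := by
  induction hs generalizing e δ with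
  | refl γ => exact ⟨δ, h, .refl _⟩
  | trans _ _ ih₁ ih₂ =>
    obtain ⟨δ₁, h₁, hs₁⟩ := ih₁ h
    obtain ⟨δ₂, h₂, hs₂⟩ := ih₂ h₁
    exact ⟨δ₂, h₂, hs₁.trans hs₂⟩
  | cons f hs ih =>
    cases h with
    | here => exact ⟨_, .here _ _, hs⟩
    | there h₁ h₂ h₃ =>
      obtain ⟨δ', h', hs'⟩ := ih h₃
      exact ⟨_, .there h₁ h₂ h', hs'.cons _⟩
  | @swap f g f' g' γ h₁ h₂ =>
    have hfg := par_fourth h₁ h₂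
    cases h with
    | here =>
      refine ⟨f :: γ, .there (e' := S.rev g') ?_ (S.par_rev h₂) (.here _ _), .refl _⟩
      obtain ⟨d, hd, hd', -⟩ := S.par_swap h₂
      rw [S.par_unique hd (S.par_rev' h₁)] at hd'
      exact S.par_rev hd'
    | @there _ _ e₁ g₁ _ δ₁ h₃ h₄ h₅ =>
      cases h₅ with
      | here =>
        obtain rfl := S.par_unique h₄ h₁
        obtain rfl := S.par_unique (S.par_rev' h₃) hfg
        exact ⟨_, .here _ _, .refl _⟩
      | @there _ _ e₂ f₂ _ δ₂ h₆ h₇ h₈ =>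
        obtain ⟨h, d, hd, hh, hd'⟩ := S.par_cube h₁ h₆ (S.par_rev' h₃)
        obtain rfl := S.par_unique hd hfg
        obtain ⟨f₃, hf₃, -⟩ := S.par_swap (S.par_rev' hd')
        obtain ⟨g₃, hg₃, -⟩ := S.par_swap hh
        refine ⟨f₃ :: g₃ :: δ₂, .there hd' hf₃ (.there (S.par_rev hh) hg₃ h₈), ?_⟩
        refine .swap δ₂ ?_ ?_
        · obtain ⟨k, d, h₉, h₁₀, h₁₁⟩ := S.par_cube h₇ hg₃ (S.par_rev' h₁)
          obtain rfl := S.par_unique h₉ (S.par_rev' h₆)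
          obtain rfl := S.par_unique h₁₁ h₄
          exact S.par_rev h₁₀
        · obtain ⟨k, d, h₉, h₁₀, h₁₁⟩ := S.par_cube hg₃ h₇ h₂
          obtain rfl := S.par_unique h₉ hh
          obtain rfl := S.par_unique h₁₁ hf₃
          exact h₁₀

theorem Cancel.shuffle_cons {γ δ : List D} {e : D} (h : S.Cancel γ e δ) :
    S.Shuffle γ (S.rev e :: δ) := by
  induction h with
  | here f γ => rw [S.rev_rev]; exact .refl _
  | @there f e e' f' γ δ h₁ h₂ _ ih =>
    refine (ih.cons f).trans (.swap δ ?_ ?_)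
    · rwa [S.rev_rev]
    · obtain ⟨d, hd, hd', -⟩ := S.par_swap h₂
      rwa [S.par_unique hd (S.par_rev' h₁)] at hd'

theorem Reduced.shuffle {γ δ : List D} (hs : S.Shuffle γ δ) (h : S.Reduced γ) : S.Reduced δ := by
  induction hs with
  | refl γ => exact h
  | trans _ _ ih₁ ih₂ => exact ih₂ (ih₁ h)
  | cons f hs ih =>
    refine ⟨ih h.1, fun δ hδ => ?_⟩
    obtain ⟨δ', h', -⟩ := hδ.shuffle hs.symm
    exact h.2 _ h'
  | @swap f g f' g' γ h₁ h₂ =>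
    obtain ⟨⟨hγ, hf⟩, hg⟩ := h
    refine ⟨⟨hγ, fun δ hδ => ?_⟩, fun δ hδ => ?_⟩
    · obtain ⟨f₁, hf₁, -⟩ := S.par_swap (S.par_rev' h₁)
      exact hg _ (.there h₁ hf₁ hδ)
    · generalize hx : f' = x at hδ
      cases hδ with
      | here => exact S.par_irrefl _ _ (hx ▸ S.par_rev h₂)
      | there h₃ h₄ h₅ =>
        subst hx
        obtain rfl := S.par_unique h₃ (S.par_rev h₂)
        exact hf _ h₅

theorem Reduced.cancel {γ δ : List D} {e : D} (h : S.Reduced γ) (hc : S.Cancel γ e δ) :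
    S.Reduced δ ∧ ∀ ε, ¬ S.Cancel δ (S.rev e) ε :=
  h.shuffle hc.shuffle_cons

variable (S)

/-- Shuffle equivalence as a setoid on reduced words. -/
def wordSetoid : Setoid {γ : List D // S.Reduced γ} where
  r γ δ := S.Shuffle γ.1 δ.1
  iseqv := ⟨fun _ => .refl _, Shuffle.symm, Shuffle.trans⟩

/-- Reduced words up to shuffles. Those that are paths from a vertex `v` are the points of the
universal cover over the vertices. -/
def Word : Type _ := Quotient S.wordSetoid

variable {S}

/-- The class of a reduced word. -/
def Word.mk (γ : List D) (h : S.Reduced γ) : S.Word := Quotient.mk S.wordSetoid ⟨γ, h⟩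

theorem Word.mk_eq_iff {γ δ : List D} {h : S.Reduced γ} {h' : S.Reduced δ} :
    Word.mk γ h = Word.mk δ h' ↔ S.Shuffle γ δ :=
  ⟨fun h => Quotient.exact h, fun h => Quotient.sound h⟩

theorem Word.exists_rep (w : S.Word) : ∃ γ h, w = Word.mk γ h := by
  obtain ⟨⟨γ, h⟩, rfl⟩ := Quotient.exists_rep w
  exact ⟨γ, h, rfl⟩

variable (S)

open scoped Classical in
/-- Multiplication of a reduced word by a dart: cancel if possible, append otherwise. -/
noncomputable def step (e : D) (γ : {γ : List D // S.Reduced γ}) : {γ : List D // S.Reduced γ} :=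
  if h : ∃ δ, S.Cancel γ.1 e δ then ⟨h.choose, (γ.2.cancel h.choose_spec).1⟩
  else ⟨e :: γ.1, γ.2, fun δ hδ => h ⟨δ, hδ⟩⟩

theorem step_of_cancel {e : D} {γ : {γ : List D // S.Reduced γ}} {δ : List D}
    (h : S.Cancel γ.1 e δ) : (S.step e γ).1 = δ := by
  have h' : ∃ δ, S.Cancel γ.1 e δ := ⟨δ, h⟩
  rw [step, dif_pos h']
  exact h'.choose_spec.unique h

theorem step_of_not_cancel {e : D} {γ : {γ : List D // S.Reduced γ}}
    (h : ∀ δ, ¬ S.Cancel γ.1 e δ) : (S.step e γ).1 = e :: γ.1 := by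
  rw [step, dif_neg (not_exists.mpr h)]

/-- The action of a dart on reduced words up to shuffles. -/
noncomputable def actFun (e : D) : S.Word → S.Word :=
  Quotient.map (S.step e) fun γ δ (hs : S.Shuffle γ.1 δ.1) => by
    change S.Shuffle _ _
    by_cases h : ∃ ε, S.Cancel γ.1 e ε
    · obtain ⟨ε, h⟩ := h
      obtain ⟨ε', h', hs'⟩ := h.shuffle hs
      rwa [S.step_of_cancel h, S.step_of_cancel h']
    · rw [not_exists] at h
      rw [S.step_of_not_cancel h, S.step_of_not_cancel]
      · exact hs.cons e
      · intro ε hε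
        obtain ⟨ε', h', -⟩ := hε.shuffle hs.symm
        exact h _ h'

variable {S}

theorem actFun_of_cancel {e : D} {γ δ : List D} {hγ : S.Reduced γ} (h : S.Cancel γ e δ) :
    S.actFun e (.mk γ hγ) = .mk δ (hγ.cancel h).1 :=
  congrArg (Quotient.mk S.wordSetoid) (Subtype.ext (S.step_of_cancel (γ := ⟨γ, hγ⟩) h))

theorem actFun_of_reduced {e : D} {γ : List D} (h : S.Reduced (e :: γ)) :
    S.actFun e (.mk γ h.1) = .mk (e :: γ) h :=
  congrArg (Quotient.mk S.wordSetoid)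
    (Subtype.ext (S.step_of_not_cancel (γ := ⟨γ, h.1⟩) h.2))

theorem actFun_rev (e : D) (w : S.Word) : S.actFun (S.rev e) (S.actFun e w) = w := by
  obtain ⟨γ, hγ, rfl⟩ := w.exists_rep
  by_cases h : ∃ ε, S.Cancel γ e ε
  · obtain ⟨ε, h⟩ := h
    have hr : S.Reduced (S.rev e :: ε) := hγ.cancel h
    rw [actFun_of_cancel h, actFun_of_reduced hr, Word.mk_eq_iff]
    exact h.shuffle_cons.symm
  · rw [not_exists] at h
    have hr : S.Reduced (e :: γ) := ⟨hγ, h⟩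
    rw [actFun_of_reduced hr, actFun_of_cancel (.here _ _)]

/-- The two ways around a square act in the same way. -/
theorem actFun_square {e f e' f' : D} (hf : S.par e f f') (he : S.par f e e') (w : S.Word) :
    S.actFun f' (S.actFun e w) = S.actFun e' (S.actFun f w) := by
  -- Moving a dart across `e` does not change whether it cancels.
  have key : ∀ {e f e' f' : D} {γ : List D}, S.par e f f' → S.par f e e' →
      (∀ δ, ¬ S.Cancel γ f δ) → ∀ δ, ¬ S.Cancel (e :: γ) f' δ := by
    intro e f e' f' γ hf he h δ hδ
    cases hδ with
    | here => exact S.par_irrefl _ _ (S.par_rev hf)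
    | there h₁ _ h₃ =>
      obtain rfl := S.par_unique h₁ (S.par_rev hf)
      exact h _ h₃
  have mixed : ∀ {e f e' f' : D} {γ ε : List D} (hγ : S.Reduced γ), S.par e f f' → S.par f e e' →
      S.Cancel γ e ε → (∀ δ, ¬ S.Cancel γ f δ) →
      S.actFun f' (S.actFun e (.mk γ hγ)) = S.actFun e' (S.actFun f (.mk γ hγ)) := by
    intro e f e' f' γ ε hγ hf he h h'
    have hred : S.Reduced (f' :: ε) := by
      refine ⟨(hγ.cancel h).1, fun δ hδ => ?_⟩
      obtain ⟨f₁, hf₁, -⟩ := S.par_swap (S.par_rev hf)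
      have : S.Cancel (S.rev e :: ε) f (f₁ :: δ) :=
        .there (by rwa [S.rev_rev]) hf₁ hδ
      obtain ⟨δ', h₁, -⟩ := this.shuffle h.shuffle_cons.symm
      exact h' _ h₁
    have hr : S.Reduced (f :: γ) := ⟨hγ, h'⟩
    rw [actFun_of_cancel h, actFun_of_reduced hred, actFun_of_reduced hr,
      actFun_of_cancel (.there (S.par_rev he) hf h)]
  obtain ⟨γ, hγ, rfl⟩ := w.exists_rep
  by_cases h : ∃ ε, S.Cancel γ e ε
  · obtain ⟨ε, h⟩ := h
    by_cases h' : ∃ ε, S.Cancel γ f ε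
    · obtain ⟨ε', h'⟩ := h'
      -- Both darts cancel: after a shuffle the word ends with the two reversed sides.
      obtain ⟨δ, hδ, hs⟩ := h'.shuffle h.shuffle_cons
      generalize hx : f = x at hδ
      cases hδ with
      | here => exact (S.par_irrefl _ _ (hx ▸ S.rev_rev e ▸ hf)).elim
      | @there _ _ f₁ e₁ _ δ h₁ h₂ h₃ =>
        subst hx
        rw [S.rev_rev] at h₁
        obtain rfl := S.par_unique h₁ hf
        obtain ⟨d, hd, hd', -⟩ := S.par_swap hf
        obtain rfl := S.par_unique hd he
        obtain rfl := S.par_unique h₂ hd'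
        rw [actFun_of_cancel h, actFun_of_cancel h₃, actFun_of_cancel h']
        have hred := (hγ.cancel h').1
        have hε' : Word.mk ε' hred = .mk _ (hred.shuffle hs) := Word.mk_eq_iff.mpr hs
        have hc : S.Cancel (S.rev d :: δ) d δ := by
          have := Cancel.here (S := S) (S.rev d) δ
          rwa [S.rev_rev] at this
        rw [hε', actFun_of_cancel hc]
    · exact mixed hγ hf he h (not_exists.mp h')
  · rw [not_exists] at h
    by_cases h' : ∃ ε, S.Cancel γ f ε
    · obtain ⟨ε', h'⟩ := h'
      exact (mixed hγ he hf h' h).symm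
    · rw [not_exists] at h'
      have hr : S.Reduced (f' :: e :: γ) := ⟨⟨hγ, h⟩, key hf he h'⟩
      have hr' : S.Reduced (e' :: f :: γ) := ⟨⟨hγ, h'⟩, key he hf h⟩
      have hre : S.Reduced (e :: γ) := ⟨hγ, h⟩
      have hrf : S.Reduced (f :: γ) := ⟨hγ, h'⟩
      rw [actFun_of_reduced hre, actFun_of_reduced hr, actFun_of_reduced hrf,
        actFun_of_reduced hr', Word.mk_eq_iff]
      exact .swap γ (S.par_rev hf) he

variable (S)

/-- The action of a dart as a permutation. -/
noncomputable def act (e : D) : Equiv.Perm S.Word where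
  toFun := S.actFun e
  invFun := S.actFun (S.rev e)
  left_inv := actFun_rev e
  right_inv w := by
    have := actFun_rev (S := S) (S.rev e) w
    rwa [S.rev_rev] at this

theorem act_rev (e : D) : S.act (S.rev e) = (S.act e)⁻¹ := by
  ext1 w; rfl

variable {S}

theorem act_square {e f e' f' : D} (hf : S.par e f f') (he : S.par f e e') :
    S.act f' * S.act e = S.act e' * S.act f :=
  Equiv.ext (actFun_square hf he)

/-- Cancelling a dart from a path leaves a path, which ends where the dart leads. -/
theorem Cancel.isPath {v : V} {γ δ : List D} {e : D} (h : S.Cancel γ e δ) (hγ : S.IsPath v γ)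
    (he : S.src e = S.endpoint v γ) : S.IsPath v δ ∧ S.endpoint v δ = S.tgt e := by
  induction h with
  | here f γ => exact ⟨hγ.1, by rw [S.tgt_rev, hγ.2]⟩
  | @there f e e' f' γ δ h₁ h₂ _ ih =>
    obtain ⟨h₃, h₄⟩ := ih hγ.1 (by rw [(S.par_src h₁).2, S.tgt_rev, hγ.2])
    refine ⟨⟨h₃, by rw [h₄, (S.par_src h₂).2]⟩, ?_⟩
    obtain ⟨d, hd, -, ht⟩ := S.par_swap h₂
    obtain rfl := S.par_unique hd (S.par_rev' h₁)
    exact ht.symm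

end DartSystem

/-! ### Flat cocycles over a contractible realization -/

/-- A covering of a contractible space has a continuous section through every point. -/
theorem IsCoveringMap.exists_section_of_contractible {E B : Type*} [TopologicalSpace E]
    [TopologicalSpace B] [ContractibleSpace B] {p : E → B} (cov : IsCoveringMap p) (e₀ : E) :
    ∃ s : C(B, E), (∀ b, p (s b) = b) ∧ s (p e₀) = e₀ := by
  obtain ⟨b₁, ⟨F⟩⟩ := id_nullhomotopic B
  let G : C(unitInterval × B, B) := F.symm.toContinuousMap
  have hG0 : ∀ b, G (0, b) = b₁ := fun b => F.symm.apply_zero b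
  have hG1 : ∀ b, G (1, b) = b := fun b => F.symm.apply_one b
  let ℓ : C(unitInterval, B) := ⟨fun t => G (t, p e₀), by fun_prop⟩
  let ℓ' : C(unitInterval, B) := ⟨fun t => ℓ (unitInterval.symm t), by fun_prop⟩
  -- The contraction moves the base point along a loop; lift it backwards from `e₀` to find the
  -- starting point of the section.
  have h0 : ℓ' 0 = p e₀ := by simp [ℓ', ℓ, hG1]
  let Γ := cov.liftPath ℓ' e₀ h0
  have hΓ : ∀ t, p (Γ t) = ℓ' t := fun t => congrFun (cov.liftPath_lifts ℓ' e₀ h0) t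
  have hΓ0 : Γ 0 = e₀ := cov.liftPath_zero ℓ' e₀ h0
  have h1 : p (Γ 1) = b₁ := by rw [hΓ]; simp [ℓ', ℓ, hG0]
  have hH : ∀ b, G (0, b) = p (ContinuousMap.const B (Γ 1) b) := fun b => by
    rw [hG0, ContinuousMap.const_apply, h1]
  let L := cov.liftHomotopy G (.const B (Γ 1)) hH
  refine ⟨⟨fun b => L (1, b), by fun_prop⟩, fun b => ?_, ?_⟩
  · have := congrFun (cov.liftHomotopy_lifts G (.const B (Γ 1)) hH) (1, b)
    exact this.trans (hG1 b)
  · let Γ' : C(unitInterval, E) := ⟨fun t => Γ (unitInterval.symm t), by fun_prop⟩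
    have hℓ : ℓ 0 = p (Γ 1) := by simp [ℓ, hG0, h1]
    have hΓ' : Γ' = cov.liftPath ℓ (Γ 1) hℓ := by
      rw [cov.eq_liftPath_iff']
      refine ⟨funext fun t => ?_, by simp [Γ']⟩
      simp [Γ', hΓ, ℓ']
    change cov.liftPath ℓ (Γ 1) hℓ 1 = e₀
    rw [← hΓ']
    simp [Γ', hΓ0]

namespace CubeComplex

section segment

variable {P : Type*}

open scoped Classical in
/-- The point with barycentric coordinate `1 - t` at `p` and `t` at `q`. -/
noncomputable def segmentPoint (p q : P) (t : ℝ) : P → ℝ :=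
  (1 - t) • Pi.single p 1 + t • Pi.single q 1

theorem segmentPoint_symm (p q : P) (t : ℝ) : segmentPoint p q t = segmentPoint q p (1 - t) := by
  simp only [segmentPoint, sub_sub_cancel]
  exact add_comm _ _

theorem continuous_segmentPoint (p q : P) : Continuous (segmentPoint p q) := by
  unfold segmentPoint
  fun_prop

theorem segmentPoint_pos (p q : P) {t : ℝ} (h0 : 0 ≤ t) (h1 : t < 1) : 0 < segmentPoint p q t p := by
  classical
  have h : 0 < 1 - t := sub_pos.mpr h1
  simp only [segmentPoint, Pi.add_apply, Pi.smul_apply, smul_eq_mul, Pi.single_apply]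
  simp only [if_true, mul_one]
  positivity

end segment

variable {P : Type*} [PartialOrder P] [Fintype P] (X : CubeComplex P) {K : Set P}

theorem segmentPoint_mem {p q : P} (hp : p ∈ K) (hq : q ∈ K) (h : p ≤ q ∨ q ≤ p) {t : ℝ}
    (h0 : 0 ≤ t) (h1 : t ≤ 1) : segmentPoint p q t ∈ X.realization K := by
  classical
  have hsupp : Function.support (segmentPoint p q t) ⊆ {p, q} := by
    intro r hr
    by_contra hr'
    simp only [Set.mem_insert_iff, Set.mem_singleton_iff, not_or] at hr'
    exact hr (by simp [segmentPoint, hr'.1, hr'.2])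
  refine ⟨fun r => ?_, ?_, ?_, ?_⟩
  · have := sub_nonneg.mpr h1
    simp only [segmentPoint, Pi.add_apply, Pi.smul_apply, smul_eq_mul, Pi.single_apply]
    positivity
  · simp [segmentPoint, Finset.sum_add_distrib, Pi.single_apply]
  · refine IsChain.mono hsupp ?_
    intro a ha b hb hab
    rcases ha with rfl | rfl <;> rcases hb with rfl | rfl <;> tauto
  · intro r hr
    rcases hsupp hr with rfl | rfl
    · exact hp
    · exact hq

/-- A flat cocycle on the chains of `K` with values in the permutations of a set has trivial
holonomy if the realization of `K` is contractible: every element over a cube `p₀` extends to a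
compatible family. -/
theorem exists_compatible_family [ContractibleSpace (X.realization K)] {F : Type*}
    (T : P → P → Equiv.Perm F)
    (hT : ∀ p q r, (p ≤ q ∨ q ≤ p) → (q ≤ r ∨ r ≤ q) → (p ≤ r ∨ r ≤ p) → T q r * T p q = T p r)
    {p₀ : P} (hp₀ : p₀ ∈ K) (f₀ : F) :
    ∃ s : P → F, s p₀ = f₀ ∧ ∀ p ∈ K, ∀ q ∈ K, p ≤ q → T p q (s p) = s q := by
  classical
  let _ : TopologicalSpace F := ⊥
  have : DiscreteTopology F := ⟨rfl⟩
  have hcomp : ∀ x : X.realization K, ∀ p q, 0 < x.1 p → 0 < x.1 q → p ≤ q ∨ q ≤ p :=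
    fun x p q hp hq => x.2.2.2.1.total (Function.mem_support.mpr hp.ne')
      (Function.mem_support.mpr hq.ne')
  have hT1 : ∀ p, T p p = 1 := fun p => by
    have := hT p p p (.inl le_rfl) (.inl le_rfl) (.inl le_rfl)
    exact mul_eq_left.mp this
  have hex : ∀ x : X.realization K, ∃ p, 0 < x.1 p := fun x => by
    by_contra! h
    have h0 := Finset.sum_nonpos fun p (_ : p ∈ Finset.univ) => h p
    rw [x.2.2.1] at h0
    exact absurd h0 (by norm_num)
  -- The covering: a bundle with discrete fibre `F`, trivial over the open stars of the vertices of
  -- the barycentric subdivision, with `T` as transition functions.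
  let Z : FiberBundleCore P (X.realization K) F :=
    { baseSet := fun p => {x | 0 < x.1 p}
      isOpen_baseSet := fun p => isOpen_lt continuous_const
        ((continuous_apply p).comp continuous_subtype_val)
      indexAt := fun x => (hex x).choose
      mem_baseSet_at := fun x => (hex x).choose_spec
      coordChange := fun p q _ => T p q
      coordChange_self := fun p x _ v => by rw [hT1]; rfl
      continuousOn_coordChange := fun p q =>
        ((continuous_of_discreteTopology (f := T p q)).comp continuous_snd).continuousOn
      coordChange_comp := fun p q r x hx v => by
        rw [← hT p q r (hcomp x p q hx.1.1 hx.1.2) (hcomp x q r hx.1.2 hx.2)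
          (hcomp x p r hx.1.1 hx.2)]
        rfl }
  have cov : IsCoveringMap (Bundle.TotalSpace.proj : Z.TotalSpace → X.realization K) :=
    FiberBundle.isCoveringMap
  let x₀ : X.realization K :=
    ⟨segmentPoint p₀ p₀ 0, X.segmentPoint_mem hp₀ hp₀ (.inl le_rfl) le_rfl zero_le_one⟩
  let e₀ : Z.TotalSpace := ⟨x₀, T p₀ (Z.indexAt x₀) f₀⟩
  obtain ⟨σ, hσ, hσ₀⟩ := cov.exists_section_of_contractible e₀
  let u : P → X.realization K → F := fun p x => (Z.localTriv p (σ x)).2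
  have hu : ∀ p, ContinuousOn (u p) (Z.baseSet p) := fun p => by
    refine continuous_snd.comp_continuousOn
      ((Z.localTriv p).continuousOn_toFun.comp σ.continuous.continuousOn fun x hx => ?_)
    rw [Bundle.Trivialization.mem_source]
    simpa [hσ] using hx
  have hTu : ∀ p q x, x ∈ Z.baseSet p → x ∈ Z.baseSet q → T p q (u p x) = u q x := by
    intro p q x hp hq
    have := Z.coordChange_comp (Z.indexAt (σ x).1) p q (σ x).1
      ⟨⟨Z.mem_baseSet_at _, by rwa [hσ]⟩, by rwa [hσ]⟩ (σ x).2
    exact this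
  let m : P → P → ℝ → X.realization K := fun p q t =>
    if h : p ∈ K ∧ q ∈ K ∧ (p ≤ q ∨ q ≤ p) ∧ 0 ≤ t ∧ t ≤ 1 then
      ⟨segmentPoint p q t, X.segmentPoint_mem h.1 h.2.1 h.2.2.1 h.2.2.2.1 h.2.2.2.2⟩ else x₀
  have hm : ∀ p q t, p ∈ K → q ∈ K → (p ≤ q ∨ q ≤ p) → 0 ≤ t → t ≤ 1 →
      (m p q t).1 = segmentPoint p q t := by
    intro p q t h₁ h₂ h₃ h₄ h₅
    simp only [m]
    rw [dif_pos ⟨h₁, h₂, h₃, h₄, h₅⟩]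
  have hconst : ∀ p ∈ K, ∀ q ∈ K, (p ≤ q ∨ q ≤ p) → u p (m p q 0) = u p (m p q (1 / 2)) := by
    intro p hp q hq hpq
    have hc : ContinuousOn (fun t => u p (m p q t)) (Set.Icc 0 (1 / 2)) := by
      refine (hu p).comp ?_ ?_
      · rw [Topology.IsInducing.subtypeVal.continuousOn_iff]
        refine (continuous_segmentPoint p q).continuousOn.congr fun t ht => ?_
        exact hm p q t hp hq hpq ht.1 (ht.2.trans (by norm_num))
      · intro t ht
        change 0 < (m p q t).1 p
        rw [hm p q t hp hq hpq ht.1 (ht.2.trans (by norm_num))]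
        exact segmentPoint_pos p q ht.1 (ht.2.trans_lt (by norm_num))
    exact isPreconnected_Icc.constant hc ⟨le_rfl, by norm_num⟩ ⟨by norm_num, le_rfl⟩
  have hm0 : ∀ p ∈ K, ∀ q ∈ K, (p ≤ q ∨ q ≤ p) → m p q 0 = m p p 0 := by
    intro p hp q hq hpq
    apply Subtype.ext
    rw [hm p q 0 hp hq hpq le_rfl zero_le_one, hm p p 0 hp hp (.inl le_rfl) le_rfl zero_le_one]
    simp [segmentPoint]
  refine ⟨fun p => u p (m p p 0), ?_, fun p hp q hq hpq => ?_⟩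
  · have hx : m p₀ p₀ 0 = x₀ := Subtype.ext (hm p₀ p₀ 0 hp₀ hp₀ (.inl le_rfl) le_rfl zero_le_one)
    have hpos : 0 < x₀.1 p₀ := segmentPoint_pos p₀ p₀ le_rfl zero_lt_one
    change u p₀ (m p₀ p₀ 0) = f₀
    rw [hx]
    change (Z.localTriv p₀ (σ e₀.1)).2 = f₀
    rw [hσ₀]
    have := Z.coordChange_comp p₀ (Z.indexAt x₀) p₀ x₀ ⟨⟨hpos, Z.mem_baseSet_at _⟩, hpos⟩ f₀
    exact this.trans (Z.coordChange_self p₀ x₀ hpos f₀)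
  · have hmid : m p q (1 / 2) = m q p (1 / 2) := by
      apply Subtype.ext
      rw [hm p q _ hp hq (.inl hpq) (by norm_num) (by norm_num),
        hm q p _ hq hp (.inr hpq) (by norm_num) (by norm_num), segmentPoint_symm]
      norm_num
    change T p q (u p (m p p 0)) = u q (m q q 0)
    rw [← hm0 p hp q hq (.inl hpq), hconst p hp q hq (.inl hpq), ← hm0 q hq p hp (.inr hpq),
      hconst q hq p hp (.inr hpq), ← hmid]
    apply hTu
    · change 0 < (m p q (1 / 2)).1 p
      rw [hm p q _ hp hq (.inl hpq) (by norm_num) (by norm_num)]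
      exact segmentPoint_pos p q (by norm_num) (by norm_num)
    · change 0 < (m p q (1 / 2)).1 q
      rw [hmid, hm q p _ hq hp (.inr hpq) (by norm_num) (by norm_num)]
      exact segmentPoint_pos q p (by norm_num) (by norm_num)

/-- If removing `L` from the realization leaves a preconnected space, then a property of cubes
outside `L` that is invariant under passing to comparable cubes holds for all or none of them. -/
theorem iff_of_isPreconnected {L : Set P}
    (h : IsPreconnected (X.realization Set.univ \ X.realization L)) (U : P → Prop)
    (hU : ∀ p ∉ L, ∀ q ∉ L, p ≤ q → (U p ↔ U q)) {p q : P} (hp : p ∉ L) (hq : q ∉ L) :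
    U p ↔ U q := by
  -- The points whose carrier contains a cube outside `L` with (without) the property form two
  -- disjoint open sets.
  by_contra hne
  wlog hpU : U p generalizing p q
  · exact this hq hp (fun h => hne h.symm) (by tauto)
  have hqU : ¬ U q := by tauto
  let A : (P → Prop) → Set (P → ℝ) := fun W => ⋃ r, ⋃ (_ : r ∉ L ∧ W r), {x | 0 < x r}
  have hA : ∀ W, IsOpen (A W) := fun W => isOpen_iUnion fun r => isOpen_iUnion fun _ =>
    isOpen_lt continuous_const (continuous_apply r)
  have hmem : ∀ r ∉ L, segmentPoint r r 0 ∈ X.realization Set.univ \ X.realization L := by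
    intro r hr
    refine ⟨X.segmentPoint_mem (Set.mem_univ r) (Set.mem_univ r) (.inl le_rfl) le_rfl zero_le_one, fun h => hr ?_⟩
    exact h.2.2.2 (Function.mem_support.mpr (segmentPoint_pos r r le_rfl zero_lt_one).ne')
  have hpos : ∀ r : P, 0 < segmentPoint r r 0 r := fun r => segmentPoint_pos r r le_rfl zero_lt_one
  obtain ⟨x, ⟨hx, -⟩, hx₁, hx₂⟩ := h (A U) (A fun r => ¬ U r) (hA _) (hA _) (by
      rintro x ⟨hx, hxL⟩
      have : ∃ r ∉ L, x r ≠ 0 := by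
        by_contra! hcon
        exact hxL ⟨hx.1, hx.2.1, hx.2.2.1, fun r hr => by_contra fun h => hr (hcon r h)⟩
      obtain ⟨r, hr, hxr⟩ := this
      have hxr' := lt_of_le_of_ne (hx.1 r) hxr.symm
      by_cases hUr : U r
      · exact .inl (Set.mem_iUnion₂.mpr ⟨r, ⟨hr, hUr⟩, hxr'⟩)
      · exact .inr (Set.mem_iUnion₂.mpr ⟨r, ⟨hr, hUr⟩, hxr'⟩))
    ⟨_, hmem p hp, Set.mem_iUnion₂.mpr ⟨p, ⟨hp, hpU⟩, hpos p⟩⟩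
    ⟨_, hmem q hq, Set.mem_iUnion₂.mpr ⟨q, ⟨hq, hqU⟩, hpos q⟩⟩
  obtain ⟨r, ⟨hr, hUr⟩, hxr⟩ := Set.mem_iUnion₂.mp hx₁
  obtain ⟨r', ⟨hr', hUr'⟩, hxr'⟩ := Set.mem_iUnion₂.mp hx₂
  rcases hx.2.2.1.total (Function.mem_support.mpr (ne_of_gt hxr))
    (Function.mem_support.mpr (ne_of_gt hxr')) with hle | hle
  · exact hUr' ((hU r hr r' hr' hle).mp hUr)
  · exact hUr' ((hU r' hr' r hr hle).mpr hUr)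

end CubeComplex

/-! ### Charts on a cube -/

/-- The face of the cube `[0,1]ⁿ` with free coordinates `A` whose other coordinates are given by
`b`. -/
def CubeFace.mk {n : ℕ} (A : Finset (Fin n)) (b : Fin n → Bool) : CubeFace n := fun i =>
  if i ∈ A then ⟨Finset.univ, Finset.univ_nonempty⟩ else ⟨{b i}, Finset.singleton_nonempty _⟩

theorem CubeFace.exists_eq_mk {n : ℕ} (F : CubeFace n) : ∃ A b, F = CubeFace.mk A b := by
  have key : ∀ s : Finset Bool, s.Nonempty → s ≠ Finset.univ → ∃ c, s = {c} := by decide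
  refine ⟨Finset.univ.filter fun i => (F i).1 = Finset.univ,
    fun i => if h : (F i).1 = Finset.univ then true else (key _ (F i).2 h).choose, ?_⟩
  funext i
  apply Subtype.ext
  by_cases h : (F i).1 = Finset.univ
  · simp only [CubeFace.mk, Finset.mem_filter, Finset.mem_univ, true_and, h, if_true]
  · simp only [CubeFace.mk, Finset.mem_filter, Finset.mem_univ, true_and, if_neg h, dif_neg h]
    exact (key _ (F i).2 h).choose_spec

theorem CubeFace.mk_le_mk {n : ℕ} {A A' : Finset (Fin n)} {b b' : Fin n → Bool} :
    CubeFace.mk A b ≤ CubeFace.mk A' b' ↔ A ⊆ A' ∧ ∀ i ∉ A', b i = b' i := by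
  have h1 : ∀ c : Bool, ¬ (Finset.univ : Finset Bool) ⊆ {c} := by decide
  have key : ∀ i, CubeFace.mk A b i ≤ CubeFace.mk A' b' i ↔ i ∈ A' ∨ (i ∉ A ∧ b i = b' i) := by
    intro i
    rw [← Subtype.coe_le_coe]
    by_cases hA : i ∈ A <;> by_cases hA' : i ∈ A' <;>
      simp [CubeFace.mk, hA, hA', h1, -Fintype.univ_bool]
  rw [Pi.le_def]
  simp only [key]
  constructor
  · intro h
    refine ⟨fun i hi => ?_, fun i hi => ?_⟩
    · rcases h i with h | h
      · exact h
      · exact (h.1 hi).elim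
    · rcases h i with h | h
      · exact (hi h).elim
      · exact h.2
  · rintro ⟨h₁, h₂⟩ i
    by_cases hi : i ∈ A'
    · exact .inl hi
    · exact .inr ⟨fun h => hi (h₁ h), h₂ i hi⟩

theorem CubeFace.card_Iic_mk {n : ℕ} (A : Finset (Fin n)) (b : Fin n → Bool) :
    Nat.card (Set.Iic (CubeFace.mk A b)) = 3 ^ A.card := by
  have e : Set.Iic (CubeFace.mk A b) ≃ ∀ i, Set.Iic (CubeFace.mk A b i) :=
    { toFun := fun F i => ⟨F.1 i, F.2 i⟩
      invFun := fun F => ⟨fun i => (F i).1, fun i => (F i).2⟩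
      left_inv := fun _ => rfl
      right_inv := fun _ => rfl }
  have h3 : Nat.card (Set.Iic (⟨Finset.univ, Finset.univ_nonempty⟩ :
      {s : Finset Bool // s.Nonempty})) = 3 := by
    rw [Nat.card_eq_fintype_card]; decide
  have h1 : ∀ c : Bool, Nat.card (Set.Iic (⟨{c}, Finset.singleton_nonempty c⟩ :
      {s : Finset Bool // s.Nonempty})) = 1 := by
    intro c; rw [Nat.card_eq_fintype_card]; revert c; decide
  rw [Nat.card_congr e, Nat.card_pi]
  have : ∀ i, Nat.card (Set.Iic (CubeFace.mk A b i)) = if i ∈ A then 3 else 1 := by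
    intro i
    unfold CubeFace.mk
    split_ifs
    · exact h3
    · exact h1 _
  simp only [this, Finset.prod_ite_mem, Finset.univ_inter, Finset.prod_const]

/-- Move along the `i`-th coordinate to the opposite vertex. -/
def flipCoord {n : ℕ} (b : Fin n → Bool) (i : Fin n) : Fin n → Bool := Function.update b i (!b i)

theorem flipCoord_same {n : ℕ} (b : Fin n → Bool) (i : Fin n) : flipCoord b i i = !b i := by
  simp [flipCoord]

theorem flipCoord_of_ne {n : ℕ} (b : Fin n → Bool) {i j : Fin n} (h : j ≠ i) :
    flipCoord b i j = b j := by
  simp [flipCoord, h]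

theorem flipCoord_flipCoord {n : ℕ} (b : Fin n → Bool) (i : Fin n) :
    flipCoord (flipCoord b i) i = b := by
  simp [flipCoord]

theorem flipCoord_comm {n : ℕ} (b : Fin n → Bool) (i j : Fin n) :
    flipCoord (flipCoord b i) j = flipCoord (flipCoord b j) i := by
  by_cases h : i = j
  · rw [h]
  · funext k
    by_cases hi : k = i <;> by_cases hj : k = j <;> 
      simp_all [flipCoord, Function.update_apply, eq_comm]

theorem flipCoord_ne {n : ℕ} (b : Fin n → Bool) (i : Fin n) : flipCoord b i ≠ b := fun h => by
  have := congrFun h i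
  simp [flipCoord] at this

namespace CubeComplex

variable {P : Type*} [PartialOrder P] (X : CubeComplex P)

/-- A choice of coordinates on the cube `p`. -/
noncomputable def chart (p : P) : Set.Iic p ≃o CubeFace (X.dim p) := (X.faces_cube p).some

/-- The face of `p` with free coordinates `A` whose other coordinates are given by `b`. -/
noncomputable def face (p : P) (A : Finset (Fin (X.dim p))) (b : Fin (X.dim p) → Bool) : P :=
  ((X.chart p).symm (.mk A b)).1

theorem face_le (p : P) (A : Finset (Fin (X.dim p))) (b : Fin (X.dim p) → Bool) :
    X.face p A b ≤ p :=
  ((X.chart p).symm (.mk A b)).2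

theorem exists_face {p q : P} (h : q ≤ p) : ∃ A b, q = X.face p A b := by
  obtain ⟨A, b, hF⟩ := CubeFace.exists_eq_mk (X.chart p ⟨q, h⟩)
  exact ⟨A, b, by rw [face, ← hF, OrderIso.symm_apply_apply]⟩

theorem face_le_face {p : P} {A A' : Finset (Fin (X.dim p))} {b b' : Fin (X.dim p) → Bool} :
    X.face p A b ≤ X.face p A' b' ↔ A ⊆ A' ∧ ∀ i ∉ A', b i = b' i := by
  rw [face, face, Subtype.coe_le_coe, OrderIso.le_iff_le, CubeFace.mk_le_mk]

theorem face_univ (p : P) (b : Fin (X.dim p) → Bool) : X.face p Finset.univ b = p := by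
  refine le_antisymm (X.face_le _ _ _) ?_
  obtain ⟨A, b', h⟩ := X.exists_face (le_refl p)
  refine h.le.trans (X.face_le_face.mpr ⟨Finset.subset_univ _, fun i hi => (hi (Finset.mem_univ i)).elim⟩)

theorem card_Iic_eq (p : P) : Nat.card (Set.Iic p) = 3 ^ X.dim p := by
  have h3 : Nat.card {s : Finset Bool // s.Nonempty} = 3 := by
    rw [Nat.card_eq_fintype_card]; decide
  rw [Nat.card_congr (X.chart p).toEquiv, Nat.card_pi]
  simp only [h3, Finset.prod_const, Finset.card_univ, Fintype.card_fin]

theorem dim_face (p : P) (A : Finset (Fin (X.dim p))) (b : Fin (X.dim p) → Bool) :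
    X.dim (X.face p A b) = A.card := by
  have e : Set.Iic (X.face p A b) ≃ Set.Iic (CubeFace.mk A b) :=
    { toFun := fun q => ⟨X.chart p ⟨q.1, q.2.trans (X.face_le p A b)⟩, by
        have : (⟨q.1, q.2.trans (X.face_le p A b)⟩ : Set.Iic p) ≤ (X.chart p).symm (.mk A b) := q.2
        exact (X.chart p).le_symm_apply.mp this⟩
      invFun := fun F => ⟨((X.chart p).symm F.1).1, by
        have : (X.chart p).symm F.1 ≤ (X.chart p).symm (.mk A b) :=
          (X.chart p).symm.monotone F.2
        exact this⟩
      left_inv := fun q => by simp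
      right_inv := fun F => Subtype.ext ((X.chart p).apply_symm_apply F.1) }
  have h := X.card_Iic_eq (X.face p A b)
  rw [Nat.card_congr e, CubeFace.card_Iic_mk] at h
  exact (Nat.pow_right_injective (by norm_num : 2 ≤ 3) h).symm

/-- The vertex of `p` with coordinates `b`. -/
noncomputable def vertexOf (p : P) (b : Fin (X.dim p) → Bool) : X.Vertex :=
  ⟨X.face p ∅ b, X.dim_face p ∅ b⟩

theorem vertexOf_le (p : P) (b : Fin (X.dim p) → Bool) : (X.vertexOf p b).1 ≤ p := X.face_le _ _ _

theorem exists_vertexOf {p : P} {v : X.Vertex} (h : v.1 ≤ p) : ∃ b, v = X.vertexOf p b := by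
  obtain ⟨A, b, hv⟩ := X.exists_face h
  have hA := X.dim_face p A b
  rw [← hv, v.2, eq_comm, Finset.card_eq_zero] at hA
  subst hA
  exact ⟨b, Subtype.ext hv⟩

theorem vertexOf_le_face {p : P} {A : Finset (Fin (X.dim p))} {b b' : Fin (X.dim p) → Bool} :
    (X.vertexOf p b).1 ≤ X.face p A b' ↔ ∀ i ∉ A, b i = b' i := by
  rw [vertexOf, face_le_face]
  simp

theorem vertexOf_injective (p : P) : Function.Injective (X.vertexOf p) := fun b b' h => by
  have : (X.vertexOf p b).1 ≤ X.face p ∅ b' := by rw [h]; exact le_rfl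
  rw [vertexOf_le_face] at this
  exact funext fun i => this i (Finset.notMem_empty i)

/-! ### Darts -/

/-- A dart: an edge with a chosen endpoint. -/
@[ext]
structure Dart where
  src : X.Vertex
  edge : P
  dim_edge : X.dim edge = 1
  src_le : src.1 ≤ edge

variable {X}

theorem Dart.exists_tgt (d : X.Dart) : ∃ w : X.Vertex, w.1 ≤ d.edge ∧ w ≠ d.src := by
  obtain ⟨b, hb⟩ := X.exists_vertexOf d.src_le
  let i : Fin (X.dim d.edge) := ⟨0, by rw [d.dim_edge]; exact one_pos⟩
  refine ⟨X.vertexOf d.edge (flipCoord b i), X.vertexOf_le _ _, fun h => ?_⟩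
  rw [hb] at h
  exact flipCoord_ne b i (X.vertexOf_injective _ h)

/-- The other endpoint of the edge. -/
noncomputable def Dart.tgt (d : X.Dart) : X.Vertex := d.exists_tgt.choose

theorem Dart.tgt_le (d : X.Dart) : d.tgt.1 ≤ d.edge := d.exists_tgt.choose_spec.1

theorem Dart.tgt_ne (d : X.Dart) : d.tgt ≠ d.src := d.exists_tgt.choose_spec.2

theorem Dart.eq_tgt (d : X.Dart) {w : X.Vertex} (hw : w.1 ≤ d.edge) (hne : w ≠ d.src) :
    w = d.tgt := by
  obtain ⟨b, hb⟩ := X.exists_vertexOf d.src_le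
  obtain ⟨b₁, h₁⟩ := X.exists_vertexOf hw
  obtain ⟨b₂, h₂⟩ := X.exists_vertexOf d.tgt_le
  have hsub : ∀ i j : Fin (X.dim d.edge), i = j := fun i j => by
    have := d.dim_edge
    omega
  have key : ∀ b' : Fin (X.dim d.edge) → Bool, b' ≠ b → b' = fun i => !b i := by
    intro b' hb'
    funext i
    by_contra h
    refine hb' (funext fun j => ?_)
    rw [hsub j i]
    cases h₁ : b' i <;> cases h₂ : b i <;> simp_all
  rw [h₁, h₂, key b₁ fun h => hne (by rw [h₁, h, ← hb]),
    key b₂ fun h => d.tgt_ne (by rw [h₂, h, ← hb])]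

/-- The same edge with the other endpoint. -/
noncomputable def Dart.rev (d : X.Dart) : X.Dart := ⟨d.tgt, d.edge, d.dim_edge, d.tgt_le⟩

theorem Dart.tgt_rev (d : X.Dart) : d.rev.tgt = d.src :=
  (d.rev.eq_tgt d.src_le d.tgt_ne.symm).symm

theorem Dart.rev_rev (d : X.Dart) : d.rev.rev = d := Dart.ext d.tgt_rev rfl

variable (X)

/-- The dart of the cube `p` that starts at the vertex `b` and runs in the direction of the `i`-th
coordinate. -/
noncomputable def dartOf (p : P) (b : Fin (X.dim p) → Bool) (i : Fin (X.dim p)) : X.Dart :=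
  ⟨X.vertexOf p b, X.face p {i} b, X.dim_face p {i} b, X.vertexOf_le_face.mpr fun _ _ => rfl⟩

theorem dartOf_le (p : P) (b : Fin (X.dim p) → Bool) (i : Fin (X.dim p)) :
    (X.dartOf p b i).edge ≤ p := X.face_le _ _ _

theorem tgt_dartOf (p : P) (b : Fin (X.dim p) → Bool) (i : Fin (X.dim p)) :
    (X.dartOf p b i).tgt = X.vertexOf p (flipCoord b i) := by
  refine (Dart.eq_tgt _ (X.vertexOf_le_face.mpr fun j hj => ?_) fun h => ?_).symm
  · exact flipCoord_of_ne b (by simpa using hj)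
  · exact flipCoord_ne b i (X.vertexOf_injective p h)

theorem face_singleton_flip (p : P) (b : Fin (X.dim p) → Bool) (i : Fin (X.dim p)) :
    X.face p {i} (flipCoord b i) = X.face p {i} b := by
  apply le_antisymm <;> rw [face_le_face] <;> refine ⟨subset_rfl, fun j hj => ?_⟩
  · exact flipCoord_of_ne b (by simpa using hj)
  · exact (flipCoord_of_ne b (by simpa using hj)).symm

theorem rev_dartOf (p : P) (b : Fin (X.dim p) → Bool) (i : Fin (X.dim p)) :
    (X.dartOf p b i).rev = X.dartOf p (flipCoord b i) i :=
  Dart.ext (X.tgt_dartOf p b i) (X.face_singleton_flip p b i).symm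

theorem exists_dartOf_of_src {p : P} {d : X.Dart} (h : d.edge ≤ p) {b : Fin (X.dim p) → Bool}
    (hb : d.src = X.vertexOf p b) : ∃ i, d = X.dartOf p b i := by
  obtain ⟨A, b', he⟩ := X.exists_face h
  have hA := X.dim_face p A b'
  rw [← he, d.dim_edge, eq_comm, Finset.card_eq_one] at hA
  obtain ⟨i, rfl⟩ := hA
  have hs := d.src_le
  rw [hb, he, vertexOf_le_face] at hs
  refine ⟨i, Dart.ext hb ?_⟩
  rw [he]
  exact le_antisymm (X.face_le_face.mpr ⟨subset_rfl, fun j hj => (hs j hj).symm⟩)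
    (X.face_le_face.mpr ⟨subset_rfl, hs⟩)

theorem exists_dartOf {p : P} {d : X.Dart} (h : d.edge ≤ p) : ∃ b i, d = X.dartOf p b i := by
  obtain ⟨b, hb⟩ := X.exists_vertexOf (d.src_le.trans h)
  obtain ⟨i, hi⟩ := X.exists_dartOf_of_src h hb
  exact ⟨b, i, hi⟩

theorem dartOf_edge_le_face {p : P} {A : Finset (Fin (X.dim p))} {b : Fin (X.dim p) → Bool}
    {i : Fin (X.dim p)} : (X.dartOf p b i).edge ≤ X.face p A b ↔ i ∈ A := by
  change X.face p {i} b ≤ _ ↔ _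
  rw [face_le_face]
  simp

theorem dartOf_inj {p : P} {b b' : Fin (X.dim p) → Bool} {i i' : Fin (X.dim p)} :
    X.dartOf p b i = X.dartOf p b' i' ↔ b = b' ∧ i = i' := by
  refine ⟨fun h => ?_, fun h => by rw [h.1, h.2]⟩
  obtain rfl := X.vertexOf_injective p (congrArg Dart.src h)
  refine ⟨rfl, ?_⟩
  have : (X.dartOf p b i).edge ≤ X.face p {i'} b := (congrArg Dart.edge h).le
  simpa [dartOf_edge_le_face] using this

variable {X}

/-- In a complex with simplicial links, a cube is contained in every cube that contains one of its
vertices together with all its edges at that vertex. -/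
theorem le_of_darts_le (hL : ∀ v, X.LinkIsSimplicial v) {p q : P} {v : X.Vertex} (hp : v.1 ≤ p)
    (hq : v.1 ≤ q) (h : ∀ d : X.Dart, d.src = v → d.edge ≤ p → d.edge ≤ q) : p ≤ q := by
  classical
  obtain ⟨b, rfl⟩ := X.exists_vertexOf hq
  rcases hp.eq_or_lt with hp | hp
  · exact hp ▸ hq
  let A : Finset (Fin (X.dim q)) := {i | (X.dartOf q b i).edge ≤ p}
  have hA : ∀ d : X.Dart, d.src = X.vertexOf q b → (d.edge ≤ p ↔ d.edge ≤ X.face q A b) := by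
    intro d hd
    constructor
    · intro hdp
      obtain ⟨i, rfl⟩ := X.exists_dartOf_of_src (h d hd hdp) hd
      rw [dartOf_edge_le_face]
      simpa [A] using hdp
    · intro hdq
      obtain ⟨i, rfl⟩ := X.exists_dartOf_of_src (hdq.trans (X.face_le _ _ _)) hd
      rw [dartOf_edge_le_face] at hdq
      simpa [A] using hdq
  have hle : (X.vertexOf q b).1 ≤ X.face q A b := X.vertexOf_le_face.mpr fun _ _ => rfl
  suffices hpA : p = X.face q A b by rw [hpA]; exact X.face_le _ _ _
  refine hL (X.vertexOf q b) p _ hp (lt_of_le_of_ne hle fun heq => ?_)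
    fun e => hA ⟨_, e.1, e.2.1, e.2.2⟩ rfl
  -- A cube of positive dimension has an edge at each of its vertices.
  obtain ⟨b', hb'⟩ := X.exists_vertexOf hp.le
  have hdim : X.dim p ≠ 0 := fun h0 => hp.ne (by
    have := X.face_univ p b'
    rw [Finset.univ_eq_empty_iff.mpr (by rw [h0]; infer_instance)] at this
    exact (congrArg Subtype.val hb').trans this)
  let i : Fin (X.dim p) := ⟨0, Nat.pos_of_ne_zero hdim⟩
  have hd := (hA (X.dartOf p b' i) hb'.symm).mp (X.dartOf_le p b' i)
  rw [← heq] at hd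
  have htgt : (X.dartOf p b' i).tgt.1 ≤ X.face q ∅ b := (X.dartOf p b' i).tgt_le.trans hd
  obtain ⟨b'', hb''⟩ := X.exists_vertexOf (htgt.trans (X.face_le _ _ _))
  rw [hb'', vertexOf_le_face] at htgt
  have : b'' = b := funext fun j => htgt j (Finset.notMem_empty j)
  exact (X.dartOf p b' i).tgt_ne (by rw [hb'', this, hb']; rfl)

variable (X) in
/-- The dart `f'` is opposite to `f` in a square spanned by `d` and `f`, and starts where `d`
ends. -/
def Par (d f f' : X.Dart) : Prop :=
  ∃ q, X.dim q = 2 ∧ d.edge ≤ q ∧ f.edge ≤ q ∧ f'.edge ≤ q ∧ d.src = f.src ∧ f'.src = d.tgt ∧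
    d.edge ≠ f.edge ∧ f'.edge ≠ d.edge

theorem dartOf_edge_ne {p : P} {b : Fin (X.dim p) → Bool} {i j : Fin (X.dim p)} (h : i ≠ j) :
    (X.dartOf p b i).edge ≠ (X.dartOf p b j).edge := fun he =>
  h (X.dartOf_inj.mp (Dart.ext (x := X.dartOf p b i) (y := X.dartOf p b j) rfl he)).2

theorem par_dartOf {p : P} (b : Fin (X.dim p) → Bool) {i j : Fin (X.dim p)} (h : i ≠ j) :
    X.Par (X.dartOf p b i) (X.dartOf p b j) (X.dartOf p (flipCoord b i) j) := by
  refine ⟨X.face p {i, j} b, ?_, ?_, ?_, ?_, rfl, (X.tgt_dartOf p b i).symm, dartOf_edge_ne h, ?_⟩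
  · rw [dim_face, Finset.card_pair h]
  · simp [dartOf_edge_le_face]
  · simp [dartOf_edge_le_face]
  · refine X.face_le_face.mpr ⟨by simp, fun k hk => ?_⟩
    simp only [Finset.mem_insert, Finset.mem_singleton, not_or] at hk
    exact flipCoord_of_ne b hk.1
  · have : (X.dartOf p b i).edge = (X.dartOf p (flipCoord b i) i).edge :=
      (X.face_singleton_flip p b i).symm
    rw [this]
    exact dartOf_edge_ne h.symm

theorem square_le (hL : ∀ v, X.LinkIsSimplicial v) {p q : P} {d f : X.Dart} (hq : X.dim q = 2)
    (hdq : d.edge ≤ q) (hfq : f.edge ≤ q) (hs : d.src = f.src) (hne : d.edge ≠ f.edge)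
    (hdp : d.edge ≤ p) (hfp : f.edge ≤ p) : q ≤ p := by
  refine le_of_darts_le hL (d.src_le.trans hdq) (d.src_le.trans hdp) fun e he heq => ?_
  obtain ⟨b, hb⟩ := X.exists_vertexOf (d.src_le.trans hdq)
  obtain ⟨i, rfl⟩ := X.exists_dartOf_of_src hdq hb
  obtain ⟨j, rfl⟩ := X.exists_dartOf_of_src hfq (hs.symm.trans hb)
  obtain ⟨k, rfl⟩ := X.exists_dartOf_of_src heq (he.trans hb)
  have hij : i ≠ j := fun h => hne (by rw [h])
  have : k = i ∨ k = j := by omega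
  rcases this with rfl | rfl
  · exact hdp
  · exact hfp

/-- In coordinates on the square, the relation `Par` has its standard form. -/
theorem Par.exists_dartOf {d f f' : X.Dart} (h : X.Par d f f') :
    ∃ (q : P) (b : Fin (X.dim q) → Bool) (i j : Fin (X.dim q)), X.dim q = 2 ∧ i ≠ j ∧
      d = X.dartOf q b i ∧ f = X.dartOf q b j ∧ f' = X.dartOf q (flipCoord b i) j := by
  obtain ⟨q, hq, hd, hf, hf', hs, hs', hne, hne'⟩ := h
  obtain ⟨b, hb⟩ := X.exists_vertexOf (d.src_le.trans hd)
  obtain ⟨i, rfl⟩ := X.exists_dartOf_of_src hd hb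
  obtain ⟨j, rfl⟩ := X.exists_dartOf_of_src hf (hs.symm.trans hb)
  obtain ⟨k, rfl⟩ := X.exists_dartOf_of_src hf' (hs'.trans (X.tgt_dartOf q b i))
  have hij : i ≠ j := fun h => hne (by rw [h])
  have hki : k ≠ i := fun h => hne' (by rw [h]; exact X.face_singleton_flip q b i)
  have : k = j := by omega
  exact ⟨q, b, i, j, hq, hij, rfl, rfl, by rw [this]⟩

theorem Par.edge_le (hL : ∀ v, X.LinkIsSimplicial v) {d f f' : X.Dart} (h : X.Par d f f') {p : P}
    (hd : d.edge ≤ p) (hf : f.edge ≤ p) : f'.edge ≤ p := by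
  obtain ⟨q, hq, hd', hf', hf'', hs, -, hne, -⟩ := h
  exact hf''.trans (square_le hL hq hd' hf' hs hne hd hf)

theorem Par.unique (hL : ∀ v, X.LinkIsSimplicial v) {d f f₁ f₂ : X.Dart} (h₁ : X.Par d f f₁)
    (h₂ : X.Par d f f₂) : f₁ = f₂ := by
  obtain ⟨q, b, i, j, hq, hij, rfl, rfl, rfl⟩ := h₂.exists_dartOf
  have hle := h₁.edge_le hL (X.dartOf_le q b i) (X.dartOf_le q b j)
  obtain ⟨-, -, -, -, -, -, hs, -, hne⟩ := h₁
  obtain ⟨k, rfl⟩ := X.exists_dartOf_of_src hle (hs.trans (X.tgt_dartOf q b i))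
  have hki : k ≠ i := fun h => hne (by rw [h]; exact X.face_singleton_flip q b i)
  have : k = j := by omega
  rw [this]

theorem Par.eq_dartOf (hL : ∀ v, X.LinkIsSimplicial v) {p : P} {b : Fin (X.dim p) → Bool}
    {i j : Fin (X.dim p)} {f' : X.Dart} (h : X.Par (X.dartOf p b i) (X.dartOf p b j) f') :
    i ≠ j ∧ f' = X.dartOf p (flipCoord b i) j := by
  have hij : i ≠ j := by
    rintro rfl
    obtain ⟨-, -, -, -, -, -, -, hne, -⟩ := h
    exact hne rfl
  exact ⟨hij, h.unique hL (par_dartOf b hij)⟩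

/-- Flag links: a set of darts at a vertex whose edges lie pairwise in common cubes lies in a single
cube. -/
theorem exists_cube_of_pairwise [Finite P] (hF : ∀ v, (X.link v).IsFlag) {v : X.Vertex}
    (s : Set X.Dart) (hs : ∀ d ∈ s, d.src = v)
    (h : ∀ d ∈ s, ∀ e ∈ s, ∃ q, d.edge ≤ q ∧ e.edge ≤ q) :
    ∃ q, v.1 ≤ q ∧ ∀ d ∈ s, d.edge ≤ q := by
  classical
  rcases s.eq_empty_or_nonempty with rfl | ⟨d₀, hd₀⟩
  · exact ⟨v.1, le_rfl, by simp⟩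
  cases nonempty_fintype P
  let t : Finset (X.EdgeAt v) := {e | ∃ d ∈ s, d.edge = e.1}
  have ht : ∀ d (hd : d ∈ s), (⟨d.edge, d.dim_edge, hs d hd ▸ d.src_le⟩ : X.EdgeAt v) ∈ t :=
    fun d hd => Finset.mem_filter.mpr ⟨Finset.mem_univ _, d, hd, rfl⟩
  obtain ⟨-, q, hq⟩ := hF v t ⟨_, ht d₀ hd₀⟩ (by
    intro a ha b hb hab
    obtain ⟨-, d, hd, hda⟩ := Finset.mem_filter.mp ha
    obtain ⟨-, e, he, heb⟩ := Finset.mem_filter.mp hb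
    obtain ⟨q, hq, hq'⟩ := h d hd e he
    refine ⟨hab, ⟨a, by simp [vertexPair]⟩, q, fun x hx => ?_⟩
    simp only [vertexPair, Finset.mem_insert, Finset.mem_singleton] at hx
    rcases hx with rfl | rfl
    · rwa [← hda]
    · rwa [← heb])
  have hq' : ∀ d ∈ s, d.edge ≤ q := fun d hd => hq _ (ht d hd)
  exact ⟨q, (hs d₀ hd₀ ▸ d₀.src_le).trans (hq' d₀ hd₀), hq'⟩

/-- The dart system of a cube complex with simplicial flag links. -/
noncomputable def dartSystem [Finite P] (hL : ∀ v, X.LinkIsSimplicial v)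
    (hF : ∀ v, (X.link v).IsFlag) : DartSystem X.Vertex X.Dart where
  src := Dart.src
  tgt := Dart.tgt
  rev := Dart.rev
  par := X.Par
  rev_rev := Dart.rev_rev
  src_rev _ := rfl
  par_src := by
    rintro d f f' ⟨q, -, -, -, -, h, h', -⟩
    exact ⟨h, h'⟩
  par_unique := Par.unique hL
  par_rev := by
    intro d f f' h
    obtain ⟨q, b, i, j, hq, hij, rfl, rfl, rfl⟩ := h.exists_dartOf
    rw [rev_dartOf]
    have := par_dartOf (flipCoord b i) hij
    rwa [flipCoord_flipCoord] at this
  par_swap := by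
    intro d f f' h
    obtain ⟨q, b, i, j, hq, hij, rfl, rfl, rfl⟩ := h.exists_dartOf
    refine ⟨X.dartOf q (flipCoord b j) i, par_dartOf b hij.symm, ?_, ?_⟩
    · rw [rev_dartOf, rev_dartOf, flipCoord_comm b j i]
      exact par_dartOf _ hij.symm
    · rw [tgt_dartOf, tgt_dartOf, flipCoord_comm]
  par_irrefl := by
    rintro d f ⟨q, -, -, -, -, -, -, h, -⟩
    exact h rfl
  par_cube := by
    intro d f g f' g' g'' h₁ h₂ h₃
    obtain ⟨q₁, -, hd₁, hf₁, -, hdf, -⟩ := id h₁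
    obtain ⟨q₂, -, hd₂, hg₂, -, hdg, -⟩ := id h₂
    obtain ⟨q₃, -, hf₃, hg₃, -, -⟩ := id h₃
    obtain ⟨p, hvp, hp⟩ := exists_cube_of_pairwise hF (v := d.src) {d, f, g}
      (by
        rintro x (rfl | rfl | rfl)
        exacts [rfl, hdf.symm, hdg.symm])
      (by
        rintro x (rfl | rfl | rfl) y (rfl | rfl | rfl)
        exacts [⟨_, le_rfl, le_rfl⟩, ⟨_, hd₁, hf₁⟩, ⟨_, hd₂, hg₂⟩, ⟨_, hf₁, hd₁⟩, ⟨_, le_rfl, le_rfl⟩,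
          ⟨_, hf₃, hg₃⟩, ⟨_, hg₂, hd₂⟩, ⟨_, hg₃, hf₃⟩, ⟨_, le_rfl, le_rfl⟩])
    have hdp := hp d (by simp)
    have hfp := hp f (by simp)
    have hgp := hp g (by simp)
    obtain ⟨b, hb⟩ := X.exists_vertexOf hvp
    obtain ⟨i, rfl⟩ := X.exists_dartOf_of_src hdp hb
    obtain ⟨j, rfl⟩ := X.exists_dartOf_of_src hfp (hdf.symm.trans hb)
    obtain ⟨k, rfl⟩ := X.exists_dartOf_of_src hgp (hdg.symm.trans hb)
    obtain ⟨hij, rfl⟩ := h₁.eq_dartOf hL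
    obtain ⟨hik, rfl⟩ := h₂.eq_dartOf hL
    obtain ⟨hjk, rfl⟩ := h₃.eq_dartOf hL
    refine ⟨X.dartOf p (flipCoord (flipCoord b i) j) k, X.dartOf p (flipCoord b j) i,
      par_dartOf b hij.symm, par_dartOf _ hjk, ?_⟩
    rw [flipCoord_comm]
    exact par_dartOf _ hik

end CubeComplex

/-! ### Uniqueness of reduced words -/

theorem eq_of_flipCoord_invariant {n : ℕ} {α : Type*} {f : (Fin n → Bool) → α}
    (hf : ∀ b i, f (flipCoord b i) = f b) (b b' : Fin n → Bool) : f b = f b' := by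
  have key : ∀ J : Finset (Fin n), ∀ b : Fin n → Bool, (∀ i ∉ J, b i = b' i) → f b = f b' := by
    intro J
    induction J using Finset.induction_on with
    | empty => exact fun b h => congrArg f (funext fun i => h i (Finset.notMem_empty i))
    | insert k J _ ih =>
      intro b h
      by_cases hk : b k = b' k
      · refine ih b fun i hi => ?_
        by_cases hik : i = k
        · rw [hik, hk]
        · exact h i (by simp [hik, hi])
      · rw [← hf b k]
        refine ih _ fun i hi => ?_
        by_cases hik : i = k
        · rw [hik, flipCoord_same]
          cases h₁ : b k <;> cases h₂ : b' k <;> simp_all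
        · rw [flipCoord_of_ne b hik]
          exact h i (by simp [hik, hi])
  exact key Finset.univ b fun i hi => (hi (Finset.mem_univ i)).elim

/-- A group-valued function on the darts of a cube that is flat on all squares is the coboundary of
a function on the vertices. -/
theorem exists_potential {n : ℕ} {G : Type*} [Group G] (A : (Fin n → Bool) → Fin n → G)
    (hinv : ∀ b i, A (flipCoord b i) i = (A b i)⁻¹)
    (hsq : ∀ b i j, i ≠ j → A (flipCoord b i) j * A b i = A (flipCoord b j) i * A b j) :
    ∃ h : (Fin n → Bool) → G, ∀ b i, A b i = h (flipCoord b i) * (h b)⁻¹ := by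
  suffices key : ∀ J : Finset (Fin n), ∃ h : (Fin n → Bool) → G,
      ∀ i ∈ J, ∀ b, A b i = h (flipCoord b i) * (h b)⁻¹ by
    obtain ⟨h, hh⟩ := key Finset.univ
    exact ⟨h, fun b i => hh i (Finset.mem_univ i) b⟩
  intro J
  induction J using Finset.induction_on with
  | empty => exact ⟨1, by simp⟩
  | insert k J hk ih =>
    obtain ⟨h, hh⟩ := ih
    -- After a gauge transformation by `h` the darts in the directions of `J` are trivial, and the
    -- value in the direction `k` does not depend on the coordinates in `J`.
    let A' : (Fin n → Bool) → G := fun b => (h (flipCoord b k))⁻¹ * A b k * h b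
    have hA'J : ∀ i ∈ J, ∀ b, A' (flipCoord b i) = A' b := by
      intro i hi b
      have hik : i ≠ k := fun h => hk (h ▸ hi)
      have h₁ := hsq b i k hik
      rw [hh i hi b, hh i hi (flipCoord b k)] at h₁
      simp only [A']
      rw [flipCoord_comm b i k]
      have h₂ : A (flipCoord b i) k * h (flipCoord b i) =
          h (flipCoord (flipCoord b k) i) * (h (flipCoord b k))⁻¹ * A b k * h b := by
        rw [← h₁]; group
      rw [mul_assoc, h₂]; group
    have hA'k : ∀ b, A' (flipCoord b k) = (A' b)⁻¹ := by
      intro b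
      simp only [A', flipCoord_flipCoord, hinv]
      group
    refine ⟨fun b => h b * if b k then (A' b)⁻¹ else 1, fun i hi b => ?_⟩
    rcases Finset.mem_insert.mp hi with rfl | hi
    · have hA : A b i = h (flipCoord b i) * A' b * (h b)⁻¹ := by simp only [A']; group
      beta_reduce
      rw [flipCoord_same, hA'k, hA]
      cases b i <;> simp [mul_assoc]
    · have hik : k ≠ i := fun h => hk (h ▸ hi)
      beta_reduce
      rw [hA'J i hi, flipCoord_of_ne b hik, hh i hi b]
      group

namespace CubeComplex

variable {P : Type*} [PartialOrder P] {X : CubeComplex P}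

theorem exists_potential_on_cube {G : Type*} [Group G] (ρ : X.Dart → G)
    (hrev : ∀ d, ρ d.rev = (ρ d)⁻¹)
    (hpar : ∀ d f d' f', X.Par d f f' → X.Par f d d' → ρ f' * ρ d = ρ d' * ρ f) (p : P) :
    ∃ h : X.Vertex → G, ∀ d : X.Dart, d.edge ≤ p → ρ d = h d.tgt * (h d.src)⁻¹ := by
  obtain ⟨h, hh⟩ := exists_potential (fun b i => ρ (X.dartOf p b i))
    (fun b i => by rw [← rev_dartOf, hrev])
    (fun b i j hij => hpar _ _ _ _ (par_dartOf b hij) (par_dartOf b hij.symm))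
  refine ⟨Function.extend (X.vertexOf p) h 1, fun d hd => ?_⟩
  obtain ⟨b, i, rfl⟩ := X.exists_dartOf hd
  rw [tgt_dartOf, (X.vertexOf_injective p).extend_apply, hh]
  congr 2
  exact ((X.vertexOf_injective p).extend_apply h 1 b).symm

theorem Vertex.eq_of_le {p : P} {v : X.Vertex} (hp : X.dim p = 0) (h : v.1 ≤ p) : v.1 = p := by
  obtain ⟨b, rfl⟩ := X.exists_vertexOf h
  have := X.face_univ p b
  rw [Finset.univ_eq_empty_iff.mpr (by rw [hp]; infer_instance)] at this
  exact this

/-- Trivial holonomy: a flat action of the darts on a set `F` admits an equivariant family over every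
subcomplex with contractible realization, with prescribed value at one vertex. -/
theorem exists_equivariant_family [Fintype P] {K : Set P} (hK : IsLowerSet K)
    [ContractibleSpace (X.realization K)] {F : Type*} (ρ : X.Dart → Equiv.Perm F)
    (hrev : ∀ d, ρ d.rev = (ρ d)⁻¹)
    (hpar : ∀ d f d' f', X.Par d f f' → X.Par f d d' → ρ f' * ρ d = ρ d' * ρ f)
    {v : X.Vertex} (hv : v.1 ∈ K) (f₀ : F) :
    ∃ s : X.Vertex → F, s v = f₀ ∧ ∀ d : X.Dart, d.edge ∈ K → s d.tgt = ρ d (s d.src) := by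
  classical
  choose h hh using exists_potential_on_cube ρ hrev hpar
  let c : P → X.Vertex := fun p => X.vertexOf p fun _ => true
  have hc : ∀ p, (c p).1 ≤ p := fun p => X.vertexOf_le p _
  have hcv : ∀ w : X.Vertex, c w.1 = w := fun w => Subtype.ext (Vertex.eq_of_le w.2 (hc w.1))
  let τ : P → P → P → Equiv.Perm F := fun m p q => h m (c q) * (h m (c p))⁻¹
  -- Two potentials on a cube differ by a constant, so the transport does not depend on the cube.
  have hτ : ∀ m m' p q, p ≤ m → q ≤ m → m ≤ m' → τ m p q = τ m' p q := by
    intro m m' p q hp hq hm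
    obtain ⟨b, hb⟩ := X.exists_vertexOf ((hc p).trans hp)
    obtain ⟨b', hb'⟩ := X.exists_vertexOf ((hc q).trans hq)
    have := eq_of_flipCoord_invariant
      (f := fun b => (h m (X.vertexOf m b))⁻¹ * h m' (X.vertexOf m b)) (fun b i => by
        have h₁ := hh m (X.dartOf m b i) (X.dartOf_le m b i)
        have h₂ := hh m' (X.dartOf m b i) ((X.dartOf_le m b i).trans hm)
        rw [tgt_dartOf] at h₁ h₂
        change ρ _ = _ * (h m (X.vertexOf m b))⁻¹ at h₁
        change ρ _ = _ * (h m' (X.vertexOf m b))⁻¹ at h₂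
        rw [h₁] at h₂
        rw [eq_mul_inv_iff_mul_eq] at h₂
        simp only [← h₂]
        group) b b'
    simp only [← hb, ← hb'] at this
    change h m (c q) * (h m (c p))⁻¹ = h m' (c q) * (h m' (c p))⁻¹
    rw [eq_mul_inv_iff_mul_eq, mul_assoc, this]
    group
  let T : P → P → Equiv.Perm F := fun p q => if p ≤ q then τ q p q else τ p p q
  have hT : ∀ m p q, (p ≤ q ∨ q ≤ p) → p ≤ m → q ≤ m → T p q = τ m p q := by
    intro m p q hpq hp hq
    by_cases hle : p ≤ q
    · simp only [T, if_pos hle]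
      exact hτ q m p q hle le_rfl hq
    · simp only [T, if_neg hle]
      exact hτ p m p q le_rfl (hpq.resolve_left hle) hp
  obtain ⟨s, hs, hs'⟩ := X.exists_compatible_family (K := K) T (by
    intro p q r hpq hqr hpr
    obtain ⟨m, hp, hq, hr⟩ : ∃ m, p ≤ m ∧ q ≤ m ∧ r ≤ m := by
      rcases hpq with h₁ | h₁ <;> rcases hqr with h₂ | h₂ <;> rcases hpr with h₃ | h₃
      exacts [⟨r, h₃, h₂, le_rfl⟩, ⟨r, h₁.trans h₂, h₂, le_rfl⟩, ⟨q, h₁, le_rfl, h₂⟩,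
        ⟨q, h₁, le_rfl, h₂⟩, ⟨r, h₃, h₂, le_rfl⟩, ⟨p, le_rfl, h₁, h₃⟩,
        ⟨p, le_rfl, h₁, h₂.trans h₁⟩, ⟨p, le_rfl, h₁, h₃⟩]
    rw [hT m q r hqr hq hr, hT m p q hpq hp hq, hT m p r hpr hp hr]
    simp only [τ]
    group) hv f₀
  refine ⟨fun w => s w.1, hs, fun d hd => ?_⟩
  have h₁ := hs' d.src.1 (hK d.src_le hd) d.edge hd d.src_le
  have h₂ := hs' d.tgt.1 (hK d.tgt_le hd) d.edge hd d.tgt_le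
  simp only [T, if_pos d.src_le, if_pos d.tgt_le, τ, hcv] at h₁ h₂
  rw [← h₁] at h₂
  simp only [Equiv.Perm.mul_apply] at h₂
  have h₃ := (h d.edge (c d.edge)).injective h₂
  rw [hh d.edge d le_rfl, Equiv.Perm.mul_apply, ← h₃]
  simp

/-- Reduced edge paths with the same endpoints that run in a subcomplex with contractible realization
agree up to shuffles. -/
theorem shuffle_of_endpoint_eq [Fintype P] (hL : ∀ v, X.LinkIsSimplicial v)
    (hF : ∀ v, (X.link v).IsFlag) {K : Set P} (hK : IsLowerSet K)
    [ContractibleSpace (X.realization K)] {v : X.Vertex} (hv : v.1 ∈ K) {γ γ' : List X.Dart}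
    (hγ : (dartSystem hL hF).IsPath v γ) (hγ' : (dartSystem hL hF).IsPath v γ')
    (hr : (dartSystem hL hF).Reduced γ) (hr' : (dartSystem hL hF).Reduced γ')
    (hγK : ∀ d ∈ γ, d.edge ∈ K) (hγK' : ∀ d ∈ γ', d.edge ∈ K)
    (he : (dartSystem hL hF).endpoint v γ = (dartSystem hL hF).endpoint v γ') :
    (dartSystem hL hF).Shuffle γ γ' := by
  obtain ⟨s, hs, hs'⟩ := exists_equivariant_family hK (dartSystem hL hF).act
    (fun d => (dartSystem hL hF).act_rev d)
    (fun d f d' f' h₁ h₂ => DartSystem.act_square (S := dartSystem hL hF) h₁ h₂) hv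
    (DartSystem.Word.mk [] trivial)
  have key : ∀ γ (hr : (dartSystem hL hF).Reduced γ), (dartSystem hL hF).IsPath v γ →
      (∀ d ∈ γ, d.edge ∈ K) →
      s ((dartSystem hL hF).endpoint v γ) = DartSystem.Word.mk γ hr := by
    intro γ
    induction γ with
    | nil => exact fun _ _ _ => hs
    | cons d γ ih =>
      intro hr hp hK
      have h₁ := ih hr.1 hp.1 fun e he => hK e (List.mem_cons_of_mem _ he)
      rw [← hp.2] at h₁
      refine (hs' d (hK d List.mem_cons_self)).trans ?_
      have h₂ : s d.src = DartSystem.Word.mk γ hr.1 := h₁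
      rw [h₂]
      exact DartSystem.actFun_of_reduced hr
  rw [← DartSystem.Word.mk_eq_iff (h := hr) (h' := hr'), ← key γ hr hγ hγK,
    ← key γ' hr' hγ' hγK', he]

end CubeComplex

/-! ### Intersections of cubes -/

namespace DartSystem

variable {V D : Type*} {S : DartSystem V D}

theorem endpoint_append (v : V) (β α : List D) :
    S.endpoint v (β ++ α) = S.endpoint (S.endpoint v α) β := by
  cases β <;> rfl

theorem isPath_append {v : V} {β α : List D} :
    S.IsPath v (β ++ α) ↔ S.IsPath v α ∧ S.IsPath (S.endpoint v α) β := by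
  induction β with
  | nil => simp [IsPath]
  | cons f β ih =>
    simp only [List.cons_append, IsPath, ih, endpoint_append]
    tauto

end DartSystem

namespace CubeComplex

variable {P : Type*} [PartialOrder P] {X : CubeComplex P}

theorem cubeDist_le_one {p : P} {v w : X.Vertex} (hv : v.1 ≤ p) (hw : w.1 ≤ p) :
    X.cubeDist v w ≤ 1 := by
  by_cases h : v = w
  · rw [h, cubeDist, SimpleGraph.edist_self]
    exact zero_le
  · have hadj : X.cubeGraph.Adj v w := ⟨h, p, hv, hw⟩
    exact (SimpleGraph.edist_eq_one_iff_adj.mpr hadj).le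

theorem exists_cube_of_cubeDist_lt_two {v w : X.Vertex} (h : X.cubeDist v w < 2) :
    ∃ p, v.1 ≤ p ∧ w.1 ≤ p := by
  by_cases hvw : v = w
  · exact ⟨v.1, le_rfl, hvw ▸ le_rfl⟩
  · have h1 : X.cubeDist v w ≤ 1 := Order.le_of_lt_add_one (by simpa [one_add_one_eq_two] using h)
    have h0 : X.cubeDist v w ≠ 0 := fun h => hvw (SimpleGraph.edist_eq_zero_iff.mp h)
    obtain ⟨-, hp⟩ :=
      SimpleGraph.edist_eq_one_iff_adj.mp (le_antisymm h1 (Order.one_le_iff_ne_zero.mpr h0))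
    exact hp

theorem isLowerSet_cubicalNeighborhood (k : ℕ) (v : X.Vertex) :
    IsLowerSet (X.cubicalNeighborhood k v) :=
  fun _ _ hqp hp w hw => hp w (hw.trans hqp)

theorem mem_cubicalNeighborhood_two {p r : P} {v w : X.Vertex} (hv : v.1 ≤ r) (hwr : w.1 ≤ r)
    (hw : w.1 ≤ p) : p ∈ X.cubicalNeighborhood 2 v := fun u hu =>
  calc X.cubeDist v u ≤ X.cubeDist v w + X.cubeDist w u := SimpleGraph.edist_triangle
    _ ≤ 1 + 1 := add_le_add (cubeDist_le_one hv hwr) (cubeDist_le_one hw hu)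
    _ = (2 : ℕ) := by norm_num

variable [Fintype P] {hL : ∀ v, X.LinkIsSimplicial v} {hF : ∀ v, (X.link v).IsFlag}

theorem Shuffle.edge_le {p : P} {γ δ : List X.Dart} (hs : (dartSystem hL hF).Shuffle γ δ)
    (hγ : ∀ d ∈ γ, d.edge ≤ p) : ∀ d ∈ δ, d.edge ≤ p := by
  induction hs with
  | refl => exact hγ
  | trans _ _ ih₁ ih₂ => exact ih₂ (ih₁ hγ)
  | cons f _ ih =>
    simp only [List.mem_cons, forall_eq_or_imp] at hγ ⊢
    exact ⟨hγ.1, ih hγ.2⟩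
  | @swap f g f' g' γ h₁ h₂ =>
    simp only [List.mem_cons, forall_eq_or_imp] at hγ ⊢
    have hg' : g'.edge ≤ p := Par.edge_le hL h₁ hγ.2.1 hγ.1
    exact ⟨Par.edge_le hL h₂ hg' hγ.2.1, hg', hγ.2.2⟩

theorem Cancel.edge_le {p : P} {γ δ : List X.Dart} {e : X.Dart}
    (h : (dartSystem hL hF).Cancel γ e δ) (hγ : ∀ d ∈ γ, d.edge ≤ p) :
    e.edge ≤ p ∧ ∀ d ∈ δ, d.edge ≤ p := by
  induction h with
  | here f γ =>
    simp only [List.mem_cons, forall_eq_or_imp] at hγ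
    exact hγ
  | @there f e e' f' γ δ h₁ h₂ _ ih =>
    simp only [List.mem_cons, forall_eq_or_imp] at hγ ⊢
    obtain ⟨he', hδ⟩ := ih hγ.2
    have h₃ : X.Par f e' e := (dartSystem hL hF).par_rev' h₁
    exact ⟨h₃.edge_le hL hγ.1 he', Par.edge_le hL h₂ he' hγ.1, hδ⟩

/-- A dart of the cube `q` that cancels in a word ending with a word of `q` either cancels
in the latter, or a parallel dart of `q` cancels in the former. -/
theorem Cancel.append {q : P} {β α δ : List X.Dart} {e : X.Dart}
    (h : (dartSystem hL hF).Cancel (β ++ α) e δ) (hβ : ∀ d ∈ β, d.edge ≤ q) (he : e.edge ≤ q) :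
    (∃ β', (dartSystem hL hF).Cancel β e β' ∧ δ = β' ++ α) ∨
    ∃ e' α' β', e'.edge ≤ q ∧ (dartSystem hL hF).Cancel α e' α' ∧ δ = β' ++ α' ∧
      ∀ d ∈ β', d.edge ≤ q := by
  induction β generalizing e δ with
  | nil => exact .inr ⟨e, δ, [], he, h, rfl, by simp⟩
  | cons f β ih =>
    simp only [List.mem_cons, forall_eq_or_imp] at hβ
    cases h with
    | here => exact .inl ⟨β, .here _ _, rfl⟩
    | @there _ _ e' f' _ δ h₁ h₂ h₃ =>
      have he' : e'.edge ≤ q := Par.edge_le hL h₁ hβ.1 he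
      rcases ih h₃ hβ.2 he' with ⟨β', hβ', rfl⟩ | ⟨e'', α', β', he'', hα', rfl, hβ'⟩
      · exact .inl ⟨f' :: β', .there h₁ h₂ hβ', rfl⟩
      · refine .inr ⟨e'', α', f' :: β', he'', hα', rfl, ?_⟩
        simp only [List.mem_cons, forall_eq_or_imp]
        exact ⟨Par.edge_le hL h₂ he' hβ.1, hβ'⟩

theorem endpoint_le {p : P} {v : X.Vertex} {γ : List X.Dart} (hv : v.1 ≤ p)
    (hγ : ∀ d ∈ γ, d.edge ≤ p) : ((dartSystem hL hF).endpoint v γ).1 ≤ p := by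
  cases γ with
  | nil => exact hv
  | cons f γ => exact f.tgt_le.trans (hγ f List.mem_cons_self)

theorem start_le {p : P} {v : X.Vertex} {γ : List X.Dart} (hγ : ∀ d ∈ γ, d.edge ≤ p)
    (hpath : (dartSystem hL hF).IsPath v γ) (he : ((dartSystem hL hF).endpoint v γ).1 ≤ p) :
    v.1 ≤ p := by
  induction γ with
  | nil => exact he
  | cons f γ ih =>
    simp only [List.mem_cons, forall_eq_or_imp] at hγ
    refine ih hγ.2 hpath.1 ?_
    rw [← hpath.2]
    exact f.src_le.trans hγ.1

theorem exists_path {p : P} {u w : X.Vertex} (hu : u.1 ≤ p) (hw : w.1 ≤ p) :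
    ∃ γ, (dartSystem hL hF).IsPath u γ ∧ (dartSystem hL hF).endpoint u γ = w ∧
      ∀ d ∈ γ, d.edge ≤ p := by
  obtain ⟨b, rfl⟩ := X.exists_vertexOf hu
  obtain ⟨b', rfl⟩ := X.exists_vertexOf hw
  have step : ∀ b₁ i, (∃ γ, (dartSystem hL hF).IsPath (X.vertexOf p b) γ ∧
      (dartSystem hL hF).endpoint (X.vertexOf p b) γ = X.vertexOf p b₁ ∧ ∀ d ∈ γ, d.edge ≤ p) →
      ∃ γ, (dartSystem hL hF).IsPath (X.vertexOf p b) γ ∧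
      (dartSystem hL hF).endpoint (X.vertexOf p b) γ = X.vertexOf p (flipCoord b₁ i) ∧
        ∀ d ∈ γ, d.edge ≤ p := by
    rintro b₁ i ⟨γ, h₁, h₂, h₃⟩
    refine ⟨X.dartOf p b₁ i :: γ, ⟨h₁, h₂.symm⟩, X.tgt_dartOf p b₁ i, ?_⟩
    simp only [List.mem_cons, forall_eq_or_imp]
    exact ⟨X.dartOf_le p b₁ i, h₃⟩
  have key := eq_of_flipCoord_invariant (f := fun b₁ => ∃ γ,
      (dartSystem hL hF).IsPath (X.vertexOf p b) γ ∧
      (dartSystem hL hF).endpoint (X.vertexOf p b) γ = X.vertexOf p b₁ ∧ ∀ d ∈ γ, d.edge ≤ p)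
    (fun b₁ i => propext ⟨fun h => by
      have := step _ i h
      rwa [flipCoord_flipCoord] at this, step b₁ i⟩) b b'
  exact key.mp ⟨[], trivial, rfl, by simp⟩

/-- A reduced path in `p` followed by a path in `q` can be reduced to a path of the same form. -/
theorem exists_reduced_append {p q : P} {v : X.Vertex} {α β : List X.Dart}
    (hr : (dartSystem hL hF).Reduced α) (hα : ∀ d ∈ α, d.edge ≤ p) (hβ : ∀ d ∈ β, d.edge ≤ q)
    (hpath : (dartSystem hL hF).IsPath v (β ++ α)) :
    ∃ β' α', (dartSystem hL hF).Reduced (β' ++ α') ∧ (dartSystem hL hF).IsPath v (β' ++ α') ∧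
      (dartSystem hL hF).endpoint v (β' ++ α') = (dartSystem hL hF).endpoint v (β ++ α) ∧
      (∀ d ∈ β', d.edge ≤ q) ∧ ∀ d ∈ α', d.edge ≤ p := by
  induction β with
  | nil => exact ⟨[], α, hr, hpath, rfl, by simp, hα⟩
  | cons f β ih =>
    simp only [List.mem_cons, forall_eq_or_imp] at hβ
    obtain ⟨β', α', hr', hp', he', hβ', hα'⟩ := ih hβ.2 hpath.1
    have hf : f.src = (dartSystem hL hF).endpoint v (β' ++ α') := hpath.2.trans he'.symm
    by_cases h : ∃ δ, (dartSystem hL hF).Cancel (β' ++ α') f δ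
    · obtain ⟨δ, h⟩ := h
      obtain ⟨hδ, hδe⟩ := h.isPath hp' hf
      have hδr := (hr'.cancel h).1
      rcases Cancel.append h hβ' hβ.1 with ⟨β'', hβ'', rfl⟩ | ⟨e, α'', β'', -, hα'', rfl, hβ''⟩
      · exact ⟨β'', α', hδr, hδ, hδe, (Cancel.edge_le hβ'' hβ').2, hα'⟩
      · exact ⟨β'', α'', hδr, hδ, hδe, hβ'', (Cancel.edge_le hα'' hα').2⟩
    · refine ⟨f :: β', α', ⟨hr', not_exists.mp h⟩, ⟨hp', hf⟩, rfl, ?_, hα'⟩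
      simp only [List.mem_cons, forall_eq_or_imp]
      exact ⟨hβ.1, hβ'⟩

theorem exists_reduced_path {p : P} {u w : X.Vertex} (hu : u.1 ≤ p) (hw : w.1 ≤ p) :
    ∃ γ, (dartSystem hL hF).Reduced γ ∧ (dartSystem hL hF).IsPath u γ ∧
      (dartSystem hL hF).endpoint u γ = w ∧ ∀ d ∈ γ, d.edge ≤ p := by
  obtain ⟨γ, h₁, h₂, h₃⟩ := exists_path (hL := hL) (hF := hF) hu hw
  obtain ⟨β, α, h₄, h₅, h₆, h₇, h₈⟩ := exists_reduced_append (p := p) (α := []) trivial (by simp)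
    h₃ (by rwa [List.append_nil])
  rw [List.append_nil, h₂] at h₆
  exact ⟨β ++ α, h₄, h₅, h₆, fun d hd => (List.mem_append.mp hd).elim (h₇ d) (h₈ d)⟩

theorem reduced_append_singleton {q : P} {β : List X.Dart} {e : X.Dart}
    (hr : (dartSystem hL hF).Reduced β) (hβ : ∀ d ∈ β, d.edge ≤ q) (he : ¬ e.edge ≤ q) :
    (dartSystem hL hF).Reduced (β ++ [e]) := by
  induction β with
  | nil => exact ⟨trivial, nofun⟩
  | cons f β ih =>
    simp only [List.mem_cons, forall_eq_or_imp] at hβ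
    refine ⟨ih hr.1 hβ.2, fun δ hδ => ?_⟩
    rcases Cancel.append hδ hβ.2 hβ.1 with ⟨β', hβ', -⟩ | ⟨e', α', β', he', hα', -⟩
    · exact hr.2 _ hβ'
    · refine he ?_
      cases hα' with
      | here => exact he'
      | there _ _ h => exact nomatch h

variable (hL hF) (h2 : ∀ v, ContractibleSpace (X.realization (X.cubicalNeighborhood 2 v)))
include hL hF h2

/-- Two vertices of a cube span a face that is contained in every cube containing both of them. -/
theorem exists_span {p : P} {u w : X.Vertex} (hu : u.1 ≤ p) (hw : w.1 ≤ p) :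
    ∃ c, u.1 ≤ c ∧ w.1 ≤ c ∧ ∀ q, u.1 ≤ q → w.1 ≤ q → c ≤ q := by
  classical
  obtain ⟨c, ⟨huc, hwc⟩, hc⟩ :=
    (Set.toFinite {c | u.1 ≤ c ∧ w.1 ≤ c}).exists_minimal ⟨p, hu, hw⟩
  refine ⟨c, huc, hwc, fun q huq hwq => ?_⟩
  refine le_of_darts_le hL huc huq fun e he hec => ?_
  obtain ⟨b, rfl⟩ := X.exists_vertexOf huc
  obtain ⟨b', rfl⟩ := X.exists_vertexOf hwc
  obtain ⟨i, rfl⟩ := X.exists_dartOf_of_src hec he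
  -- By minimality the two vertices are opposite corners of `c`, so there is a reduced path between
  -- them that starts with a given dart and then stays in the opposite facet.
  have hi : b' i = !b i := by
    by_contra hi
    have hbi : b' i = b i := by cases h₁ : b' i <;> cases h₂ : b i <;> simp_all
    have hle := hc (y := X.face c (Finset.univ.erase i) b) ⟨X.vertexOf_le_face.mpr fun _ _ => rfl,
      X.vertexOf_le_face.mpr fun j hj => by
        have : j = i := by simpa using hj
        rw [this, hbi]⟩ (X.face_le _ _ _)
    have := (X.dartOf_le c b i).trans hle
    rw [dartOf_edge_le_face] at this
    simp at this
  let c' := X.face c (Finset.univ.erase i) (flipCoord b i)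
  have h₁ : (X.vertexOf c (flipCoord b i)).1 ≤ c' := X.vertexOf_le_face.mpr fun _ _ => rfl
  have h₂ : (X.vertexOf c b').1 ≤ c' := X.vertexOf_le_face.mpr fun j hj => by
    have : j = i := by simpa using hj
    rw [this, hi, flipCoord_same]
  have h₃ : ¬ (X.dartOf c b i).edge ≤ c' := by
    have : (X.dartOf c b i).edge = (X.dartOf c (flipCoord b i) i).edge :=
      (X.face_singleton_flip c b i).symm
    rw [this, dartOf_edge_le_face]
    simp
  obtain ⟨β, hβr, hβp, hβe, hβ⟩ := exists_reduced_path (hL := hL) (hF := hF) h₁ h₂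
  obtain ⟨γ, hγr, hγp, hγe, hγ⟩ := exists_reduced_path (hL := hL) (hF := hF) huq hwq
  have hend : (dartSystem hL hF).endpoint (X.vertexOf c b) [X.dartOf c b i] =
    X.vertexOf c (flipCoord b i) := X.tgt_dartOf c b i
  have hmem : ∀ r : P, (X.vertexOf c b).1 ≤ r → r ∈ X.cubicalNeighborhood 2 (X.vertexOf c b) :=
    fun r hr => mem_cubicalNeighborhood_two hr hr hr
  have := h2 (X.vertexOf c b)
  have hpath : (dartSystem hL hF).IsPath (X.vertexOf c b) (β ++ [X.dartOf c b i]) :=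
    DartSystem.isPath_append.mpr ⟨⟨trivial, rfl⟩, by rwa [hend]⟩
  have hs := shuffle_of_endpoint_eq hL hF (isLowerSet_cubicalNeighborhood 2 (X.vertexOf c b))
    (hmem _ le_rfl) hγp
    hpath hγr
    (reduced_append_singleton hβr hβ h₃)
    (fun d hd => isLowerSet_cubicalNeighborhood 2 _ (hγ d hd) (hmem q huq))
    (fun d hd => by
      refine isLowerSet_cubicalNeighborhood 2 _ ?_ (hmem c huc)
      rcases List.mem_append.mp hd with hd | hd
      · exact (hβ d hd).trans (X.face_le _ _ _)
      · rw [List.mem_singleton.mp hd]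
        exact X.dartOf_le c b i)
    (by rw [hγe, DartSystem.endpoint_append, hend, hβe])
  exact Shuffle.edge_le hs hγ _ (by simp)

/-- A Helly property: three cubes that meet pairwise in vertices have a common vertex. -/
theorem exists_common_vertex {p q r : P} {a b c : X.Vertex} (hap : a.1 ≤ p) (hbp : b.1 ≤ p)
    (hbq : b.1 ≤ q) (hcq : c.1 ≤ q) (har : a.1 ≤ r) (hcr : c.1 ≤ r) :
    ∃ m : X.Vertex, m.1 ≤ p ∧ m.1 ≤ q ∧ m.1 ≤ r := by
  obtain ⟨α, hαr, hαp, hαe, hα⟩ := exists_reduced_path (hL := hL) (hF := hF) hap hbp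
  obtain ⟨β, hβp, hβe, hβ⟩ := exists_path (hL := hL) (hF := hF) hbq hcq
  obtain ⟨γ, hγr, hγp, hγe, hγ⟩ := exists_reduced_path (hL := hL) (hF := hF) har hcr
  obtain ⟨β', α', hr', hp', he', hβ', hα'⟩ := exists_reduced_append (v := a) hαr hα hβ
    (DartSystem.isPath_append.mpr ⟨hαp, by rwa [hαe]⟩)
  rw [DartSystem.endpoint_append (v := a) β α, hαe, hβe] at he'
  have := h2 a
  have hs := shuffle_of_endpoint_eq hL hF (isLowerSet_cubicalNeighborhood 2 a)
    (mem_cubicalNeighborhood_two le_rfl le_rfl le_rfl) hγp hp' hγr hr'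
    (fun d hd => isLowerSet_cubicalNeighborhood 2 a (hγ d hd)
      (mem_cubicalNeighborhood_two har har har))
    (fun d hd => by
      rcases List.mem_append.mp hd with hd | hd
      · exact isLowerSet_cubicalNeighborhood 2 a (hβ' d hd)
          (mem_cubicalNeighborhood_two har hcr hcq)
      · exact isLowerSet_cubicalNeighborhood 2 a (hα' d hd)
          (mem_cubicalNeighborhood_two hap hap hap))
    (hγe.trans he'.symm)
  have hle := Shuffle.edge_le hs hγ
  refine ⟨(dartSystem hL hF).endpoint a α', endpoint_le hap hα', ?_,
    endpoint_le har fun d hd => hle d (List.mem_append_right _ hd)⟩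
  rw [DartSystem.endpoint_append] at he'
  exact start_le hβ' (DartSystem.isPath_append.mp hp').2 (by rw [he']; exact hcq)

theorem exists_cube_of_triple {p q r : P} {a b c : X.Vertex} (hap : a.1 ≤ p) (hbp : b.1 ≤ p)
    (hbq : b.1 ≤ q) (hcq : c.1 ≤ q) (har : a.1 ≤ r) (hcr : c.1 ≤ r) :
    ∃ t, a.1 ≤ t ∧ b.1 ≤ t ∧ c.1 ≤ t := by
  obtain ⟨m, hmp, hmq, hmr⟩ := exists_common_vertex hL hF h2 hap hbp hbq hcq har hcr
  obtain ⟨A, hmA, haA, hA⟩ := exists_span hL hF h2 hmp hap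
  obtain ⟨B, hmB, hbB, hB⟩ := exists_span hL hF h2 hmp hbp
  obtain ⟨C, hmC, hcC, hC⟩ := exists_span hL hF h2 hmq hcq
  have hAp := hA p hmp hap
  have hAr := hA r hmr har
  have hBp := hB p hmp hbp
  have hBq := hB q hmq hbq
  have hCq := hC q hmq hcq
  have hCr := hC r hmr hcr
  obtain ⟨t, hmt, ht⟩ := exists_cube_of_pairwise hF (v := m)
    {d | d.src = m ∧ (d.edge ≤ A ∨ d.edge ≤ B ∨ d.edge ≤ C)} (fun d hd => hd.1) (by
      rintro d ⟨-, hd⟩ e ⟨-, he⟩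
      rcases hd with hd | hd | hd <;> rcases he with he | he | he
      exacts [⟨A, hd, he⟩, ⟨p, hd.trans hAp, he.trans hBp⟩, ⟨r, hd.trans hAr, he.trans hCr⟩,
        ⟨p, hd.trans hBp, he.trans hAp⟩, ⟨B, hd, he⟩, ⟨q, hd.trans hBq, he.trans hCq⟩,
        ⟨r, hd.trans hCr, he.trans hAr⟩, ⟨q, hd.trans hCq, he.trans hBq⟩, ⟨C, hd, he⟩])
  exact ⟨t, haA.trans (le_of_darts_le hL hmA hmt fun d hd hdA => ht d ⟨hd, .inl hdA⟩),
    hbB.trans (le_of_darts_le hL hmB hmt fun d hd hdB => ht d ⟨hd, .inr (.inl hdB)⟩),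
    hcC.trans (le_of_darts_le hL hmC hmt fun d hd hdC => ht d ⟨hd, .inr (.inr hdC)⟩)⟩

/-- Vertices that lie pairwise in common cubes lie in a single cube. -/
theorem exists_cube_of_clique {B : Set X.Vertex} (hB : B.Nonempty)
    (h : ∀ u ∈ B, ∀ w ∈ B, ∃ p, u.1 ≤ p ∧ w.1 ≤ p) : ∃ p, ∀ u ∈ B, u.1 ≤ p := by
  obtain ⟨b, hb⟩ := hB
  have hspan : ∀ c ∈ B, ∃ s, b.1 ≤ s ∧ c.1 ≤ s ∧ ∀ q, b.1 ≤ q → c.1 ≤ q → s ≤ q := fun c hc => by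
    obtain ⟨p, hp, hp'⟩ := h b hb c hc
    exact exists_span hL hF h2 hp hp'
  have : Nonempty P := ⟨b.1⟩
  choose! s hbs hcs hs using hspan
  obtain ⟨t, hbt, ht⟩ := exists_cube_of_pairwise hF (v := b)
    {d | d.src = b ∧ ∃ c ∈ B, d.edge ≤ s c} (fun d hd => hd.1) (by
      rintro d ⟨-, c, hc, hd⟩ e ⟨-, c', hc', he⟩
      obtain ⟨p, hp, hp'⟩ := h b hb c hc
      obtain ⟨q, hq, hq'⟩ := h c hc c' hc'
      obtain ⟨r, hr, hr'⟩ := h b hb c' hc'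
      obtain ⟨t, h₁, h₂, h₃⟩ := exists_cube_of_triple hL hF h2 hp hp' hq hq' hr hr'
      exact ⟨t, hd.trans (hs c hc t h₁ h₂), he.trans (hs c' hc' t h₁ h₃)⟩)
  exact ⟨t, fun c hc => (hcs c hc).trans
    (le_of_darts_le hL (hbs c hc) hbt fun d hd hdc => ht d ⟨hd, c, hc, hdc⟩)⟩

/-- A cube is contained in every cube that contains all its vertices. -/
theorem le_of_vertices_le {p q : P} (h : ∀ v : X.Vertex, v.1 ≤ q → v.1 ≤ p) : q ≤ p := by
  let u := X.vertexOf q fun _ => false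
  let w := X.vertexOf q fun _ => true
  have hu : u.1 ≤ q := X.vertexOf_le _ _
  have hw : w.1 ≤ q := X.vertexOf_le _ _
  obtain ⟨c, huc, hwc, hc⟩ := exists_span hL hF h2 hu hw
  obtain ⟨A, b, rfl⟩ := X.exists_face (hc q hu hw)
  have hA : A = Finset.univ := by
    by_contra hA
    obtain ⟨i, hi⟩ : ∃ i, i ∉ A := by
      by_contra! hcon
      exact hA (Finset.eq_univ_iff_forall.mpr hcon)
    exact absurd ((X.vertexOf_le_face.mp huc i hi).trans (X.vertexOf_le_face.mp hwc i hi).symm)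
      (by simp)
  have := hc p (h u hu) (h w hw)
  rwa [hA, face_univ] at this

end CubeComplex

/-! ### Legal states -/

namespace CubeComplex

variable {P : Type*} [PartialOrder P] {X : CubeComplex P}

theorem thickening_adj {y z : X.TVertex} (hne : y ≠ z) {p : P} (hy : y.1.1.1 ≤ p)
    (hz : z.1.1.1 ≤ p) : X.thickening.oneSkeletonGraph.Adj y z := by
  refine ⟨hne, ⟨y, by simp [vertexPair]⟩, p, fun x hx => ?_⟩
  simp only [vertexPair, Finset.mem_insert, Finset.mem_singleton] at hx
  rcases hx with rfl | rfl
  · exact hy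
  · exact hz

/-- The pair `w_v` for `v_w`. -/
def TVertex.swap (y : X.TVertex) : X.TVertex :=
  ⟨y.1.swap, by
    have := y.2
    rw [cubeDist, SimpleGraph.edist_comm] at this
    exact this⟩

theorem isMoveAt_pairMove (y : X.TVertex) :
    X.thickening.oneSkeletonGraph.IsMoveAt y (X.pairMove y) := by
  classical
  refine ⟨by simp [pairMove], fun u hu => ?_⟩
  obtain ⟨hne, -, p, hp⟩ := hu
  have hup : u.1.1.1 ≤ p := hp u (by simp [vertexPair])
  have hyp : y.1.1.1 ≤ p := hp y (by simp [vertexPair])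
  have h : ¬ (u.1 = y.1 ∨ u.1 = y.1.swap) := by
    rintro (h | h)
    · exact hne (Subtype.ext h)
    · have h₁ : u.1.1 = y.1.2 := congrArg Prod.fst h
      rw [h₁] at hup
      exact absurd (y.2.trans (cubeDist_le_one hyp hup)) (by norm_num)
  simp [pairMove, h]

theorem initialState_swap {k : ℕ} (x : X.Vertex ≃ Fin k) (y : X.TVertex) :
    X.initialState x y.swap = X.initialState x y + 1 := by
  have hne : x y.1.1 ≠ x y.1.2 := fun h => by
    have := y.2
    rw [x.injective h, cubeDist, SimpleGraph.edist_self] at this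
    exact absurd this (by norm_num)
  have h₁ : y.swap.1.1 = y.1.2 := rfl
  have h₂ : y.swap.1.2 = y.1.1 := rfl
  unfold initialState
  rw [h₁, h₂]
  rcases lt_or_gt_of_ne hne with h | h
  · rw [if_neg h.not_gt, if_pos h]; decide
  · rw [if_pos h, if_neg h.not_gt]; decide

theorem apply_swap_of_mem_closure {μ : X.TVertex → ZMod 2}
    (hμ : μ ∈ AddSubgroup.closure (Set.range X.pairMove)) (y : X.TVertex) : μ y.swap = μ y := by
  induction hμ using AddSubgroup.closure_induction with
  | mem _ h =>
    obtain ⟨z, rfl⟩ := h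
    have h₁ : y.1.swap = z.1 ↔ y.1 = z.1.swap := Prod.swap_eq_iff_eq_swap
    have h₂ : y.1.swap = z.1.swap ↔ y.1 = z.1 := Prod.swap_injective.eq_iff
    have h₃ : y.swap.1 = y.1.swap := rfl
    have h : (y.swap.1 = z.1 ∨ y.swap.1 = z.1.swap) ↔ (y.1 = z.1 ∨ y.1 = z.1.swap) := by
      rw [h₃, h₁, h₂, or_comm]
    unfold pairMove
    by_cases hc : y.1 = z.1 ∨ y.1 = z.1.swap
    · rw [if_pos (h.mpr hc), if_pos hc]
    · rw [if_neg (mt h.mp hc), if_neg hc]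
  | zero => rfl
  | add _ _ _ _ h₁ h₂ => simp only [Pi.add_apply, h₁, h₂]
  | neg _ _ h => simp only [Pi.neg_apply, h]

/-- A state that takes different values at `v_w` and `w_v` for all `v`, `w` is legal. -/
theorem isLegalState_of_swap [Fintype P] [Nonempty P] (h5 : X.IsFiveLarge)
    (hcubes : X.NoDisconnectingCubes) (hcorners : X.NoIsolatedCorners) {φ : X.TVertex → ZMod 2}
    (hφ : ∀ y : X.TVertex, φ y.swap = φ y + 1) :
    X.thickening.oneSkeletonGraph.IsLegalState φ := by
  have hL : ∀ v, X.LinkIsSimplicial v := fun v => (h5.1 v).1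
  have hF : ∀ v, (X.link v).IsFlag := fun v => (h5.1 v).2.1
  have h2 := h5.2
  intro ε
  -- The vertices `v` for which no `v_w` has state `ε` lie in a common cube.
  obtain ⟨p, hp⟩ : ∃ p : P, ∀ v : X.Vertex, ¬ v.1 ≤ p → ∃ y : X.TVertex, y.1.1 = v ∧ φ y = ε := by
    let B : Set X.Vertex := {v | ¬ ∃ y : X.TVertex, y.1.1 = v ∧ φ y = ε}
    rcases B.eq_empty_or_nonempty with hB | hB
    · refine ⟨Classical.arbitrary P, fun v _ => by_contra fun h => ?_⟩
      have : v ∈ B := h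
      simp [hB] at this
    · obtain ⟨p, hp⟩ := exists_cube_of_clique hL hF h2 hB (by
        intro u hu w hw
        by_cases h : 2 ≤ X.cubeDist u w
        · let y : X.TVertex := ⟨(u, w), h⟩
          have h₁ : φ y ≠ ε := fun h => hu ⟨y, rfl, h⟩
          have h₂ : φ y.swap ≠ ε := fun h => hw ⟨y.swap, rfl, h⟩
          rw [hφ] at h₂
          have key : ∀ a c : ZMod 2, a ≠ c → a + 1 ≠ c → False := by decide
          exact (key _ _ h₁ h₂).elim
        · exact exists_cube_of_cubeDist_lt_two (not_le.mp h))
      exact ⟨p, fun v hv => by_contra fun h => hv (hp v h)⟩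
  obtain ⟨z₀, hz₀⟩ : ∃ z : X.Vertex, ¬ z.1 ≤ p := by
    obtain ⟨w, -, hw⟩ := hcorners p (X.vertexOf p fun _ => true) (X.vertexOf_le _ _)
    exact ⟨w, hw⟩
  obtain ⟨y₀, hy₀, hy₀ε⟩ := hp z₀ hz₀
  let G := X.thickening.oneSkeletonGraph.induce {v | φ v = ε}
  let o : {v | φ v = ε} := ⟨y₀, hy₀ε⟩
  have hadj : ∀ (y z : {v | φ v = ε}) (q : P), y.1.1.1.1 ≤ q → z.1.1.1.1 ≤ q → G.Reachable y z := by
    intro y z q hy hz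
    by_cases hyz : y = z
    · rw [hyz]
    · have : G.Adj y z := thickening_adj (fun h => hyz (Subtype.ext h)) hy hz
      exact this.reachable
  let U : P → Prop := fun q => ∃ y : {v | φ v = ε}, y.1.1.1.1 ≤ q ∧ G.Reachable y o
  have hU : ∀ q ∉ Set.Iic p, ∀ q' ∉ Set.Iic p, U q ↔ U q' := by
    intro q hq q' hq'
    refine X.iff_of_isPreconnected (hcubes p) U (fun r hr r' _ hle => ?_) hq hq'
    refine ⟨fun ⟨y, hy, hyo⟩ => ⟨y, hy.trans hle, hyo⟩, fun ⟨y, hy, hyo⟩ => ?_⟩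
    obtain ⟨v, hvr, hvp⟩ : ∃ v : X.Vertex, v.1 ≤ r ∧ ¬ v.1 ≤ p := by
      by_contra! hcon
      exact hr (le_of_vertices_le hL hF h2 hcon)
    obtain ⟨z, hz, hzε⟩ := hp v hvp
    refine ⟨⟨z, hzε⟩, by rwa [hz], (hadj _ y r' ?_ hy).trans hyo⟩
    rw [hz]
    exact hvr.trans hle
  have hreach : ∀ y : {v | φ v = ε}, ¬ y.1.1.1.1 ≤ p → G.Reachable y o := by
    intro y hy
    obtain ⟨z, hz, hzo⟩ := (hU z₀.1 hz₀ y.1.1.1.1 hy).mp ⟨o, by rw [hy₀], .rfl⟩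
    exact (hadj y z _ le_rfl hz).trans hzo
  have hreach' : ∀ y : {v | φ v = ε}, G.Reachable y o := by
    intro y
    by_cases hy : y.1.1.1.1 ≤ p
    · obtain ⟨w, ⟨-, e, -, hve, hwe⟩, hw⟩ := hcorners p y.1.1.1 hy
      obtain ⟨z, rfl, hzε⟩ := hp w hw
      exact (hadj y ⟨z, hzε⟩ e hve hwe).trans (hreach ⟨z, hzε⟩ hw)
    · exact hreach y hy
  exact (SimpleGraph.connected_iff_exists_forall_reachable G).mpr ⟨o, fun y => (hreach' y).symm⟩

end CubeComplex

theorem mainTheorem2 {P : Type*} [PartialOrder P] [Fintype P] (X : CubeComplex P)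
    (hconn : IsConnected (X.realization Set.univ))
    (h5 : X.IsFiveLarge)
    (hcubes : X.NoDisconnectingCubes)
    (hcorners : X.NoIsolatedCorners)
    {k : ℕ} (x : X.Vertex ≃ Fin k) :
    X.thickening.oneSkeletonGraph.IsLegalSystemOfMoves X.pairMove ∧
      X.thickening.oneSkeletonGraph.IsLegalOrbit X.pairMove (X.initialState x) := by
  have : Nonempty P := by
    obtain ⟨f, -, hf, -⟩ := hconn.nonempty
    by_contra h
    rw [not_nonempty_iff] at h
    simp at hf
  have horbit : X.thickening.oneSkeletonGraph.IsLegalOrbit X.pairMove (X.initialState x) := by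
    refine ⟨CubeComplex.isLegalState_of_swap h5 hcubes hcorners
      (CubeComplex.initialState_swap x), fun μ hμ => ?_⟩
    refine CubeComplex.isLegalState_of_swap h5 hcubes hcorners fun y => ?_
    rw [Pi.add_apply, Pi.add_apply, CubeComplex.apply_swap_of_mem_closure hμ,
      CubeComplex.initialState_swap, add_assoc]
  exact ⟨⟨CubeComplex.isMoveAt_pairMove, _, horbit⟩, horbit⟩
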